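/- Let $(M,g)$ be a compact connected smooth Riemannian manifold without boundary, of dimension $m$, let $(N,h)$ be a smooth Riemannian manifold, and let $\alpha>0$ be a constant. Let $u:M\to N$, $f:M\to\mathbb R$ and $\sigma:M\to\mathbb R$ be smooth. Assume that $(g,u,f,\sigma)$ is a gradient almost Ricci-harmonic soliton (gradient almost $(RH)_\alpha$ soliton), that is, $$Rc-\alpha\,\nabla u\otimes\nabla u+\mathrm{Hess}\,f=\sigma g,\qquad \tau_g u-\langle\nabla u,\nabla f\rangle=0\quad\text{on } M,$$ where $Rc$ is the Ricci tensor of $g$, $\nabla u\otimes\nabla u=u^*h$ is the pullback of $h$ by $u$, $\tau_g u=\mathrm{trace}_g\nabla du$ is the tension field of $u$, and $\langle\nabla u,\nabla f\rangle=du(\nabla f)$. Assume moreover that $\Delta\sigma\le 0$ on $M$, where $\Delta=\mathrm{trace}_g\mathrm{Hess}$ is the Laplace-Beltrami operator. If the soliton is steady ($\sigma=0$ everywhere on $M$) or expanding ($\sigma<0$ everywhere on $M$), then the function $$S=R-\alpha|\nabla u|^2=\mathrm{trace}_g\big(Rc-\alpha\,\nabla u\otimes\nabla u\big),$$ where $R$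 is the scalar curvature of $g$, is constant on $M$. -/

import Mathlib

open scoped Manifold ContDiff Bundle Topology

noncomputable section

namespace RHSoliton

/-- Partial derivative `∂ᵢ F (y)` of a real function on `ℝᵐ`. -/
def pd {m : ℕ} (i : Fin m) (F : EuclideanSpace ℝ (Fin m) → ℝ)
    (y : EuclideanSpace ℝ (Fin m)) : ℝ :=
  fderiv ℝ F y (EuclideanSpace.single i 1)

/-! Local formulas: `G` is the matrix `(g_{ij})` of a metric as a function of the coordinates. -/

section Local

variable {m : ℕ} (G : EuclideanSpace ℝ (Fin m) → Matrix (Fin m) (Fin m) ℝ)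

/-- Christoffel symbols of the Levi-Civita connection,
`Γᵏᵢⱼ = ½ gᵏˡ (∂ᵢ gⱼₗ + ∂ⱼ gᵢₗ - ∂ₗ gᵢⱼ)`. -/
def christoffel (k i j : Fin m) (y : EuclideanSpace ℝ (Fin m)) : ℝ :=
  (1 / 2 : ℝ) * ∑ l, (G y)⁻¹ k l *
    (pd i (fun z => G z j l) y + pd j (fun z => G z i l) y - pd l (fun z => G z i j) y)

/-- Riemann curvature: `R(∂ᵢ, ∂ⱼ) ∂ₖ = ∑ₗ (riemann G l i j k) ∂ₗ`, where
`R(X, Y) = ∇_X ∇_Y - ∇_Y ∇_X - ∇_[X, Y]`. -/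
def riemann (l i j k : Fin m) (y : EuclideanSpace ℝ (Fin m)) : ℝ :=
  pd i (christoffel G l j k) y - pd j (christoffel G l i k) y
    + ∑ p, (christoffel G l i p y * christoffel G p j k y
      - christoffel G l j p y * christoffel G p i k y)

/-- Ricci curvature, `Rc(Y, Z) = trace (X ↦ R(X, Y) Z)`. -/
def ricci (j k : Fin m) (y : EuclideanSpace ℝ (Fin m)) : ℝ :=
  ∑ i, riemann G i i j k y

/-- Hessian of a function, `∂ᵢ∂ⱼ F - Γᵏᵢⱼ ∂ₖ F`. -/
def hess (F : EuclideanSpace ℝ (Fin m) → ℝ) (i j : Fin m)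
    (y : EuclideanSpace ℝ (Fin m)) : ℝ :=
  pd i (pd j F) y - ∑ k, christoffel G k i j y * pd k F y

/-- Metric trace `gⁱʲ Tᵢⱼ` of a `(0,2)`-tensor at the point with coordinates `y`. -/
def metricTrace (T : Fin m → Fin m → ℝ) (y : EuclideanSpace ℝ (Fin m)) : ℝ :=
  ∑ i, ∑ j, (G y)⁻¹ i j * T i j

/-- Components of `trace_g ∇dU` for a map `U` from `(ℝᵐ, G)` to `(ℝⁿ, H)`:
`gⁱʲ (∂ᵢ∂ⱼ U^c - Γᵏᵢⱼ ∂ₖ U^c + (Γ^H)^c_{ab}(U) ∂ᵢ U^a ∂ⱼ U^b)`. -/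
def tension {n : ℕ} (H : EuclideanSpace ℝ (Fin n) → Matrix (Fin n) (Fin n) ℝ)
    (U : EuclideanSpace ℝ (Fin m) → EuclideanSpace ℝ (Fin n)) (c : Fin n)
    (y : EuclideanSpace ℝ (Fin m)) : ℝ :=
  metricTrace G (fun i j => hess G (fun z => U z c) i j y
    + ∑ a, ∑ b, christoffel H c a b (U y) * pd i (fun z => U z a) y * pd j (fun z => U z b) y) y

/-- `⟨∇F, ∇K⟩ = gⁱʲ ∂ᵢ F ∂ⱼ K`. -/
def gradInner (F K : EuclideanSpace ℝ (Fin m) → ℝ) (y : EuclideanSpace ℝ (Fin m)) : ℝ :=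
  metricTrace G (fun i j => pd i F y * pd j K y) y

end Local

/-! Global objects on manifolds. -/

/-- A smooth Riemannian metric on a smooth `m`-manifold. -/
abbrev Metric (m : ℕ) (M : Type*) [TopologicalSpace M]
    [ChartedSpace (EuclideanSpace ℝ (Fin m)) M] [IsManifold (𝓡 m) ∞ M] :=
  Bundle.ContMDiffRiemannianMetric (𝓡 m) ∞ (EuclideanSpace ℝ (Fin m))
    (fun x : M => TangentSpace (𝓡 m) x)

section Global

variable {m n : ℕ}
  {M : Type*} [TopologicalSpace M] [ChartedSpace (EuclideanSpace ℝ (Fin m)) M]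
  [IsManifold (𝓡 m) ∞ M]
  {N : Type*} [TopologicalSpace N] [ChartedSpace (EuclideanSpace ℝ (Fin n)) N]
  [IsManifold (𝓡 n) ∞ N]

/-- The coordinate vector field `∂ᵢ` of the chart `e`, at the point with coordinates `y`. -/
def coordVec (e : OpenPartialHomeomorph M (EuclideanSpace ℝ (Fin m))) (i : Fin m)
    (y : EuclideanSpace ℝ (Fin m)) : TangentSpace (𝓡 m) (e.symm y) :=
  mfderiv (𝓡 m) (𝓡 m) e.symm y (EuclideanSpace.single i (1 : ℝ) : EuclideanSpace ℝ (Fin m))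

/-- The matrix `g_{ij} = g(∂ᵢ, ∂ⱼ)` of the metric in the chart `e`. -/
def metricCoeff (g : Metric m M) (e : OpenPartialHomeomorph M (EuclideanSpace ℝ (Fin m)))
    (y : EuclideanSpace ℝ (Fin m)) : Matrix (Fin m) (Fin m) ℝ :=
  Matrix.of fun i j => g.inner (e.symm y) (coordVec e i y) (coordVec e j y)

/-- Components `(u^*h)(∂ᵢ, ∂ⱼ)` of `∇u ⊗ ∇u = u^*h` in the chart `e`. -/
def pullbackCoeff (h : Metric n N) (u : M → N)
    (e : OpenPartialHomeomorph M (EuclideanSpace ℝ (Fin m))) (i j : Fin m)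
    (y : EuclideanSpace ℝ (Fin m)) : ℝ :=
  h.inner (u (e.symm y)) (mfderiv (𝓡 m) (𝓡 n) u (e.symm y) (coordVec e i y))
    (mfderiv (𝓡 m) (𝓡 n) u (e.symm y) (coordVec e j y))

/-- Components of `Sc = Rc - α ∇u ⊗ ∇u` in the chart `e`. -/
def scCoeff (g : Metric m M) (h : Metric n N) (α : ℝ) (u : M → N)
    (e : OpenPartialHomeomorph M (EuclideanSpace ℝ (Fin m))) (i j : Fin m)
    (y : EuclideanSpace ℝ (Fin m)) : ℝ :=
  ricci (metricCoeff g e) i j y - α * pullbackCoeff h u e i j y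

/-- `S = trace_g Sc = R - α |∇u|²`. -/
def scalarS (g : Metric m M) (h : Metric n N) (α : ℝ) (u : M → N) (x : M) : ℝ :=
  let e := chartAt (EuclideanSpace ℝ (Fin m)) x
  metricTrace (metricCoeff g e) (fun i j => scCoeff g h α u e i j (e x)) (e x)

/-- The Laplace-Beltrami operator `Δf = trace_g Hess f`. -/
def laplacian (g : Metric m M) (f : M → ℝ) (x : M) : ℝ :=
  let e := chartAt (EuclideanSpace ℝ (Fin m)) x
  metricTrace (metricCoeff g e) (fun i j => hess (metricCoeff g e) (f ∘ e.symm) i j (e x)) (e x)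

/-- `(g, u, f, σ)` is a gradient almost `(RH)_α` soliton: `u`, `f`, `σ` are smooth and, in all
local coordinates of `M` and `N`,
`Rc - α ∇u ⊗ ∇u + Hess f = σ g` and `τ_g u - ⟨∇u, ∇f⟩ = 0`. -/
structure IsGradientAlmostSoliton (g : Metric m M) (h : Metric n N) (α : ℝ)
    (u : M → N) (f σ : M → ℝ) : Prop where
  smooth_map : ContMDiff (𝓡 m) (𝓡 n) ∞ u
  smooth_potential : ContMDiff (𝓡 m) 𝓘(ℝ, ℝ) ∞ f
  smooth_sigma : ContMDiff (𝓡 m) 𝓘(ℝ, ℝ) ∞ σ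
  ricci_eq : ∀ e ∈ IsManifold.maximalAtlas (𝓡 m) ∞ M, ∀ x ∈ e.source, ∀ i j : Fin m,
    scCoeff g h α u e i j (e x) + hess (metricCoeff g e) (f ∘ e.symm) i j (e x)
      = σ x * metricCoeff g e (e x) i j
  tension_eq : ∀ e ∈ IsManifold.maximalAtlas (𝓡 m) ∞ M,
    ∀ d ∈ IsManifold.maximalAtlas (𝓡 n) ∞ N, ∀ x ∈ e.source, u x ∈ d.source → ∀ c : Fin n,
    tension (metricCoeff g e) (metricCoeff h d) (d ∘ u ∘ e.symm) c (e x)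
      - gradInner (metricCoeff g e) (fun y => (d (u (e.symm y))) c) (f ∘ e.symm) (e x) = 0

end Global

/-- The soliton is steady: `σ` vanishes on `M`. -/
def IsSteady {M : Type*} (σ : M → ℝ) : Prop := ∀ x, σ x = 0

/-- The soliton is expanding: `σ` is negative on `M`. -/
def IsExpanding {M : Type*} (σ : M → ℝ) : Prop := ∀ x, σ x < 0

end RHSoliton

end

noncomputable section

set_option linter.unusedSectionVars false

namespace RHSoliton

/-! Calculus of partial derivatives. -/

section Calculus

variable {m n : ℕ} {W : Set (EuclideanSpace ℝ (Fin m))} {y : EuclideanSpace ℝ (Fin m)}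
  {F K : EuclideanSpace ℝ (Fin m) → ℝ}

/-! The proof applies the strong minimum principle twice (`exists_eq_const_of_laplacian_nonpos`).
Applied to σ, it makes σ a constant c, and c ≤ 0 in both the steady and the expanding case. Tracing
the soliton equation then gives S = c m - Δf (`scalarS_eq`), so it is enough that f be constant, and
for this that Δf ≤ 0.

Once σ = c, the function Q = Δf - |∇f|² + 2cf satisfies dQ = 0, as in Hamilton's identity for Ricci
solitons. Take twice the divergence of the soliton equation minus the differential of its trace. The
contracted Bianchi identity removes Rc, the Ricci identity turns the Hessian part into dΔf + 2
Rc(∇f), and the tension equation turns the map part into 2 u^*h(∇f). Contracting the soliton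
equation with ∇f eliminates the remaining Rc and u^*h.

At a maximum point of Δf, dQ = 0 reads Hess f(∇f) = c∇f, whence Rc(∇f,∇f) = α|du(∇f)|². Bochner's
formula and ΔQ = 0 then give 0 ≥ ΔΔf = 2|Hess f|² + 2α|du(∇f)|² - 2cΔf. If Δf > 0 there, every term
on the right is nonnegative, so Hess f = 0 and Δf = 0, a contradiction
(`laplacian_nonpos_of_isMax`). Hence f is superharmonic, so constant.

The tensor identities are computed at the centre of coordinates in which the metric is the identity
to first order (`exists_normal_chart`): Christoffel symbols vanish there, and first covariant
derivatives of tensors are partial derivatives. `IsChange` carries scalars between charts. The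
minimum principle is Hopf's, with the barrier argument in `not_touching`. -/

theorem diffAt (hW : IsOpen W) (hy : y ∈ W) (hF : ContDiffOn ℝ ∞ F W) : DifferentiableAt ℝ F y :=
  (hF.contDiffAt (hW.mem_nhds hy)).differentiableAt (by simp)

theorem contDiffOn_pd (hW : IsOpen W) (hF : ContDiffOn ℝ ∞ F W) (i : Fin m) :
    ContDiffOn ℝ ∞ (pd i F) W :=
  (hF.fderiv_of_isOpen hW (m := ∞) (by simp)).clm_apply contDiffOn_const

theorem pd_congr (hW : IsOpen W) (hy : y ∈ W) (h : ∀ z ∈ W, F z = K z) (i : Fin m) :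
    pd i F y = pd i K y := by
  have : F =ᶠ[𝓝 y] K := Filter.eventually_of_mem (hW.mem_nhds hy) h
  simp only [pd, this.fderiv_eq]

theorem pd_const (c : ℝ) (i : Fin m) : pd i (fun _ => c) y = 0 := by
  simp [pd]

theorem pd_add (hF : DifferentiableAt ℝ F y) (hK : DifferentiableAt ℝ K y) (i : Fin m) :
    pd i (fun z => F z + K z) y = pd i F y + pd i K y := by
  simp [pd, fderiv_fun_add hF hK]

theorem pd_sub (hF : DifferentiableAt ℝ F y) (hK : DifferentiableAt ℝ K y) (i : Fin m) :
    pd i (fun z => F z - K z) y = pd i F y - pd i K y := by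
  simp [pd, fderiv_fun_sub hF hK]

theorem pd_const_mul (hF : DifferentiableAt ℝ F y) (c : ℝ) (i : Fin m) :
    pd i (fun z => c * F z) y = c * pd i F y := by
  simp [pd, fderiv_const_mul hF c]

theorem pd_mul (hF : DifferentiableAt ℝ F y) (hK : DifferentiableAt ℝ K y) (i : Fin m) :
    pd i (fun z => F z * K z) y = pd i F y * K y + F y * pd i K y := by
  simp [pd, fderiv_fun_mul hF hK]; ring

theorem pd_sum {ι : Type*} (s : Finset ι) {A : ι → EuclideanSpace ℝ (Fin m) → ℝ}
    (hA : ∀ a ∈ s, DifferentiableAt ℝ (A a) y) (i : Fin m) :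
    pd i (fun z => ∑ a ∈ s, A a z) y = ∑ a ∈ s, pd i (A a) y := by
  simp [pd, fderiv_fun_sum hA]

theorem pd_comm (hW : IsOpen W) (hy : y ∈ W) (hF : ContDiffOn ℝ ∞ F W) (i j : Fin m) :
    pd i (pd j F) y = pd j (pd i F) y := by
  have hc := hF.contDiffAt (hW.mem_nhds hy)
  have hd : DifferentiableAt ℝ (fderiv ℝ F) y :=
    (hc.fderiv_right (m := 1) (by norm_cast)).differentiableAt (by simp)
  have key : ∀ a b : Fin m, pd a (pd b F) y
      = fderiv ℝ (fderiv ℝ F) y (EuclideanSpace.single a 1) (EuclideanSpace.single b 1) := by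
    intro a b
    unfold pd
    rw [fderiv_clm_apply hd (differentiableAt_const _)]
    simp
  rw [key, key]
  exact (hc.isSymmSndFDerivAt (by simp; norm_cast)) _ _

theorem fderiv_eq_sum_pd (v : EuclideanSpace ℝ (Fin m)) :
    fderiv ℝ F y v = ∑ i, v i * pd i F y := by
  have hv : v = ∑ i, v i • EuclideanSpace.single i (1 : ℝ) := by
    ext j; simp [Pi.single_apply]
  conv_lhs => rw [hv]
  simp [pd]

theorem pd_comp {φ : EuclideanSpace ℝ (Fin m) → EuclideanSpace ℝ (Fin n)}
    {K : EuclideanSpace ℝ (Fin n) → ℝ} (hK : DifferentiableAt ℝ K (φ y))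
    (hφ : DifferentiableAt ℝ φ y) (i : Fin m) :
    pd i (fun z => K (φ z)) y = ∑ a, pd a K (φ y) * pd i (fun z => φ z a) y := by
  have h1 : fderiv ℝ (fun z => K (φ z)) y = (fderiv ℝ K (φ y)).comp (fderiv ℝ φ y) :=
    fderiv_comp y hK hφ
  have h2 : ∀ a, pd i (fun z => φ z a) y = (fderiv ℝ φ y (EuclideanSpace.single i 1)) a := by
    intro a
    have := ((EuclideanSpace.proj a : EuclideanSpace ℝ (Fin n) →L[ℝ] ℝ).hasFDerivAt.comp y
      hφ.hasFDerivAt).fderiv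
    change fderiv ℝ (fun z => φ z a) y _ = _
    have h3 : ((EuclideanSpace.proj a : EuclideanSpace ℝ (Fin n) →L[ℝ] ℝ) ∘ φ)
      = fun z => φ z a := rfl
    rw [h3] at this
    rw [this]; rfl
  rw [pd, h1, ContinuousLinearMap.comp_apply, fderiv_eq_sum_pd]
  exact Finset.sum_congr rfl fun a _ => by rw [h2, mul_comm]

theorem pd_pd_mul (hW : IsOpen W) (hy : y ∈ W) (hF : ContDiffOn ℝ ∞ F W)
    (hK : ContDiffOn ℝ ∞ K W) (i j : Fin m) :
    pd i (pd j (fun z => F z * K z)) y = pd i (pd j F) y * K y + pd j F y * pd i K y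
      + pd i F y * pd j K y + F y * pd i (pd j K) y := by
  rw [pd_congr hW hy (fun z hz => pd_mul (diffAt hW hz hF) (diffAt hW hz hK) j) i,
    pd_add, pd_mul, pd_mul]
  · ring
  all_goals
    apply diffAt hW hy
    first
      | assumption
      | exact contDiffOn_pd hW (by assumption) _
      | exact (contDiffOn_pd hW hF _).mul hK
      | exact hF.mul (contDiffOn_pd hW hK _)

theorem pd_pd_sum {ι : Type*} (s : Finset ι) {A : ι → EuclideanSpace ℝ (Fin m) → ℝ}
    (hW : IsOpen W) (hy : y ∈ W) (hA : ∀ a ∈ s, ContDiffOn ℝ ∞ (A a) W) (i j : Fin m) :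
    pd i (pd j (fun z => ∑ a ∈ s, A a z)) y = ∑ a ∈ s, pd i (pd j (A a)) y := by
  rw [pd_congr hW hy (fun z hz => pd_sum s (fun a ha => diffAt hW hz (hA a ha)) j) i,
    pd_sum s (fun a ha => diffAt hW hy (contDiffOn_pd hW (hA a ha) j))]

theorem pd_pd_const_mul (hW : IsOpen W) (hy : y ∈ W) (hF : ContDiffOn ℝ ∞ F W) (c : ℝ)
    (i j : Fin m) : pd i (pd j (fun z => c * F z)) y = c * pd i (pd j F) y := by
  rw [pd_congr hW hy (fun z hz => pd_const_mul (diffAt hW hz hF) c j) i,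
    pd_const_mul (diffAt hW hy (contDiffOn_pd hW hF j))]

theorem pd_pd_add (hW : IsOpen W) (hy : y ∈ W) (hF : ContDiffOn ℝ ∞ F W)
    (hK : ContDiffOn ℝ ∞ K W) (i j : Fin m) :
    pd i (pd j (fun z => F z + K z)) y = pd i (pd j F) y + pd i (pd j K) y := by
  rw [pd_congr hW hy (fun z hz => pd_add (diffAt hW hz hF) (diffAt hW hz hK) j) i,
    pd_add (diffAt hW hy (contDiffOn_pd hW hF j)) (diffAt hW hy (contDiffOn_pd hW hK j))]

theorem pd_pd_sub (hW : IsOpen W) (hy : y ∈ W) (hF : ContDiffOn ℝ ∞ F W)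
    (hK : ContDiffOn ℝ ∞ K W) (i j : Fin m) :
    pd i (pd j (fun z => F z - K z)) y = pd i (pd j F) y - pd i (pd j K) y := by
  rw [pd_congr hW hy (fun z hz => pd_sub (diffAt hW hz hF) (diffAt hW hz hK) j) i,
    pd_sub (diffAt hW hy (contDiffOn_pd hW hF j)) (diffAt hW hy (contDiffOn_pd hW hK j))]

/-! ### Smoothness of the inverse metric, Christoffel symbols, Hessian, Ricci tensor and traces. -/

variable {G : EuclideanSpace ℝ (Fin m) → Matrix (Fin m) (Fin m) ℝ}

theorem contDiffOn_det {k : ℕ} {B : EuclideanSpace ℝ (Fin m) → Matrix (Fin k) (Fin k) ℝ}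
    (hB : ∀ i j, ContDiffOn ℝ ∞ (fun z => B z i j) W) :
    ContDiffOn ℝ ∞ (fun z => (B z).det) W := by
  simp only [Matrix.det_apply]
  refine ContDiffOn.sum fun s _ => ContDiffOn.const_smul _ ?_
  exact contDiffOn_prod fun i _ => hB _ _

/-- Cramer's rule: adjugate entries are determinants of matrices with smooth entries. -/
theorem contDiffOn_inv (hG : ∀ i j, ContDiffOn ℝ ∞ (fun z => G z i j) W)
    (hdet : ∀ z ∈ W, (G z).det ≠ 0) (i j : Fin m) :
    ContDiffOn ℝ ∞ (fun z => (G z)⁻¹ i j) W := by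
  have h1 : ContDiffOn ℝ ∞ (fun z => (G z).adjugate i j) W := by
    simp only [Matrix.adjugate_apply]
    refine contDiffOn_det fun a b => ?_
    by_cases h : a = j
    · subst h; simpa using contDiffOn_const
    · simpa [Matrix.updateRow_apply, h] using hG a b
  simp only [Matrix.inv_def, Matrix.smul_apply, smul_eq_mul, Ring.inverse_eq_inv']
  exact ((contDiffOn_det hG).inv hdet).mul h1

theorem contDiffOn_christoffel (hW : IsOpen W) (hG : ∀ i j, ContDiffOn ℝ ∞ (fun z => G z i j) W)
    (hdet : ∀ z ∈ W, (G z).det ≠ 0) (k i j : Fin m) :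
    ContDiffOn ℝ ∞ (christoffel G k i j) W := by
  unfold christoffel
  refine contDiffOn_const.mul (ContDiffOn.sum fun l _ => (contDiffOn_inv hG hdet k l).mul ?_)
  exact ((contDiffOn_pd hW (hG _ _) _).add (contDiffOn_pd hW (hG _ _) _)).sub
    (contDiffOn_pd hW (hG _ _) _)

theorem contDiffOn_hess (hW : IsOpen W) (hG : ∀ i j, ContDiffOn ℝ ∞ (fun z => G z i j) W)
    (hdet : ∀ z ∈ W, (G z).det ≠ 0) (hF : ContDiffOn ℝ ∞ F W) (i j : Fin m) :
    ContDiffOn ℝ ∞ (hess G F i j) W := by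
  unfold hess
  exact (contDiffOn_pd hW (contDiffOn_pd hW hF j) i).sub
    (ContDiffOn.sum fun k _ => (contDiffOn_christoffel hW hG hdet k i j).mul
      (contDiffOn_pd hW hF k))

theorem contDiffOn_ricci (hW : IsOpen W) (hG : ∀ i j, ContDiffOn ℝ ∞ (fun z => G z i j) W)
    (hdet : ∀ z ∈ W, (G z).det ≠ 0) (j k : Fin m) : ContDiffOn ℝ ∞ (ricci G j k) W := by
  unfold ricci riemann
  have hΓ := contDiffOn_christoffel hW hG hdet
  refine ContDiffOn.sum fun i _ => ContDiffOn.add ?_ ?_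
  · exact (contDiffOn_pd hW (hΓ _ _ _) _).sub (contDiffOn_pd hW (hΓ _ _ _) _)
  · exact ContDiffOn.sum fun p _ => ((hΓ _ _ _).mul (hΓ _ _ _)).sub ((hΓ _ _ _).mul (hΓ _ _ _))

theorem contDiffOn_metricTrace (hG : ∀ i j, ContDiffOn ℝ ∞ (fun z => G z i j) W)
    (hdet : ∀ z ∈ W, (G z).det ≠ 0) {T : Fin m → Fin m → EuclideanSpace ℝ (Fin m) → ℝ}
    (hT : ∀ i j, ContDiffOn ℝ ∞ (T i j) W) :
    ContDiffOn ℝ ∞ (fun z => metricTrace G (fun i j => T i j z) z) W := by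
  unfold metricTrace
  exact ContDiffOn.sum fun i _ => ContDiffOn.sum fun j _ => (contDiffOn_inv hG hdet i j).mul (hT i j)

theorem contDiffOn_gradInner (hW : IsOpen W) (hG : ∀ i j, ContDiffOn ℝ ∞ (fun z => G z i j) W)
    (hdet : ∀ z ∈ W, (G z).det ≠ 0) (hF : ContDiffOn ℝ ∞ F W) (hK : ContDiffOn ℝ ∞ K W) :
    ContDiffOn ℝ ∞ (gradInner G F K) W := by
  unfold gradInner
  exact contDiffOn_metricTrace hG hdet (T := fun i j z => pd i F z * pd j K z)
    fun i j => (contDiffOn_pd hW hF i).mul (contDiffOn_pd hW hK j)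

end Calculus

/-! Identities at the centre of normal coordinates. -/

/-- `G` is a smooth field of symmetric invertible matrices on the open set `W`. -/
structure SmoothMetricOn {m : ℕ} (G : EuclideanSpace ℝ (Fin m) → Matrix (Fin m) (Fin m) ℝ)
    (W : Set (EuclideanSpace ℝ (Fin m))) : Prop where
  isOpen : IsOpen W
  smooth : ∀ i j, ContDiffOn ℝ ∞ (fun z => G z i j) W
  symm : ∀ z ∈ W, ∀ i j, G z i j = G z j i
  det_ne : ∀ z ∈ W, (G z).det ≠ 0

/-- `G` is a metric on `W` which is the identity to first order at `y`. -/
structure NormalAt {m : ℕ} (G : EuclideanSpace ℝ (Fin m) → Matrix (Fin m) (Fin m) ℝ)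
    (W : Set (EuclideanSpace ℝ (Fin m))) (y : EuclideanSpace ℝ (Fin m)) : Prop
    extends SmoothMetricOn G W where
  mem : y ∈ W
  eq_one : G y = 1
  pd_eq_zero : ∀ k i j, pd k (fun z => G z i j) y = 0

/-- Twice the Christoffel symbols of the first kind. -/
def lowerChristoffel {m : ℕ} (G : EuclideanSpace ℝ (Fin m) → Matrix (Fin m) (Fin m) ℝ)
    (i j l : Fin m) (y : EuclideanSpace ℝ (Fin m)) : ℝ :=
  pd i (fun z => G z j l) y + pd j (fun z => G z i l) y - pd l (fun z => G z i j) y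

section Normal

variable {m : ℕ} {G : EuclideanSpace ℝ (Fin m) → Matrix (Fin m) (Fin m) ℝ}
  {W : Set (EuclideanSpace ℝ (Fin m))} {y : EuclideanSpace ℝ (Fin m)}
  {F : EuclideanSpace ℝ (Fin m) → ℝ}

theorem SmoothMetricOn.contDiffOn_inv (hG : SmoothMetricOn G W) (i j : Fin m) :
    ContDiffOn ℝ ∞ (fun z => (G z)⁻¹ i j) W :=
  RHSoliton.contDiffOn_inv hG.smooth hG.det_ne i j

theorem SmoothMetricOn.contDiffOn_lower (hG : SmoothMetricOn G W) (i j l : Fin m) :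
    ContDiffOn ℝ ∞ (lowerChristoffel G i j l) W :=
  ((contDiffOn_pd hG.isOpen (hG.smooth _ _) _).add
    (contDiffOn_pd hG.isOpen (hG.smooth _ _) _)).sub (contDiffOn_pd hG.isOpen (hG.smooth _ _) _)

theorem NormalAt.inv_eq (hG : NormalAt G W y) : (G y)⁻¹ = 1 := by
  rw [hG.eq_one, inv_one]

theorem NormalAt.metricTrace_eq (hG : NormalAt G W y) (T : Fin m → Fin m → ℝ) :
    metricTrace G T y = ∑ i, T i i := by
  simp [metricTrace, hG.inv_eq, Matrix.one_apply]

theorem SmoothMetricOn.sum_inv_mul (hG : SmoothMetricOn G W) {z} (hz : z ∈ W) (i k : Fin m) :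
    ∑ j, (G z)⁻¹ i j * G z j k = (1 : Matrix (Fin m) (Fin m) ℝ) i k := by
  rw [← Matrix.mul_apply, Matrix.nonsing_inv_mul _ (isUnit_iff_ne_zero.mpr (hG.det_ne z hz))]

theorem NormalAt.pd_inv (hG : NormalAt G W y) (l i k : Fin m) :
    pd l (fun z => (G z)⁻¹ i k) y = 0 := by
  have h := pd_congr hG.isOpen hG.mem (fun z hz => hG.sum_inv_mul hz i k) l
  rw [pd_const, pd_sum _ (fun j _ => diffAt hG.isOpen hG.mem
    ((hG.contDiffOn_inv i j).mul (hG.smooth j k)))] at h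
  rw [← h, eq_comm]
  have : ∀ j, pd l (fun z => (G z)⁻¹ i j * G z j k) y
      = pd l (fun z => (G z)⁻¹ i j) y * (1 : Matrix (Fin m) (Fin m) ℝ) j k := by
    intro j
    rw [pd_mul (diffAt hG.isOpen hG.mem (hG.contDiffOn_inv i j))
      (diffAt hG.isOpen hG.mem (hG.smooth j k)), hG.pd_eq_zero, hG.eq_one]
    ring
  simp [this, Matrix.one_apply]

/-- Differentiate g⁻¹g = 1 twice; the mixed products of first derivatives vanish at the centre. -/
theorem NormalAt.pd_pd_inv (hG : NormalAt G W y) (l p i k : Fin m) :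
    pd l (pd p (fun z => (G z)⁻¹ i k)) y = - pd l (pd p (fun z => G z i k)) y := by
  have h0 : ∀ z ∈ W, pd p (fun z => ∑ j, (G z)⁻¹ i j * G z j k) z = 0 := fun z hz => by
    rw [pd_congr hG.isOpen hz (fun z hz => hG.sum_inv_mul hz i k) p, pd_const]
  have h := pd_congr hG.isOpen hG.mem h0 l
  rw [pd_const, pd_pd_sum _ hG.isOpen hG.mem (fun j _ => (hG.contDiffOn_inv i j).mul
    (hG.smooth j k))] at h
  have : ∀ j, pd l (pd p (fun z => (G z)⁻¹ i j * G z j k)) y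
      = pd l (pd p (fun z => (G z)⁻¹ i j)) y * (1 : Matrix (Fin m) (Fin m) ℝ) j k
        + (1 : Matrix (Fin m) (Fin m) ℝ) i j * pd l (pd p (fun z => G z j k)) y := by
    intro j
    rw [pd_pd_mul hG.isOpen hG.mem (hG.contDiffOn_inv i j) (hG.smooth j k), hG.pd_inv, hG.pd_inv,
      hG.eq_one, inv_one]
    ring
  simp only [this, Finset.sum_add_distrib, Matrix.one_apply] at h
  simp at h
  linarith

theorem NormalAt.lower_eq_zero (hG : NormalAt G W y) (i j l : Fin m) :
    lowerChristoffel G i j l y = 0 := by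
  simp [lowerChristoffel, hG.pd_eq_zero]

theorem NormalAt.christoffel_eq_zero (hG : NormalAt G W y) (k i j : Fin m) :
    christoffel G k i j y = 0 := by
  simp [christoffel, hG.pd_eq_zero]

theorem christoffel_eq_lower (k i j : Fin m) : christoffel G k i j
    = fun z => (1 / 2 : ℝ) * ∑ l, (G z)⁻¹ k l * lowerChristoffel G i j l z := rfl

theorem NormalAt.pd_christoffel (hG : NormalAt G W y) (l k i j : Fin m) :
    pd l (christoffel G k i j) y = (1 / 2) * pd l (lowerChristoffel G i j k) y := by
  have hs : ∀ q, ContDiffOn ℝ ∞ (fun z => (G z)⁻¹ k q * lowerChristoffel G i j q z) W :=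
    fun q => (hG.contDiffOn_inv k q).mul (hG.contDiffOn_lower i j q)
  rw [christoffel_eq_lower, pd_const_mul (diffAt hG.isOpen hG.mem (ContDiffOn.sum fun q _ => hs q)),
    pd_sum _ (fun q _ => diffAt hG.isOpen hG.mem (hs q))]
  congr 1
  have : ∀ q, pd l (fun z => (G z)⁻¹ k q * lowerChristoffel G i j q z) y
      = (1 : Matrix (Fin m) (Fin m) ℝ) k q * pd l (lowerChristoffel G i j q) y := by
    intro q
    rw [pd_mul (diffAt hG.isOpen hG.mem (hG.contDiffOn_inv k q))
      (diffAt hG.isOpen hG.mem (hG.contDiffOn_lower i j q)), hG.pd_inv, hG.inv_eq]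
    ring
  simp [this, Matrix.one_apply]

theorem NormalAt.pd_pd_christoffel (hG : NormalAt G W y) (l p k i j : Fin m) :
    pd l (pd p (christoffel G k i j)) y
      = (1 / 2) * pd l (pd p (lowerChristoffel G i j k)) y := by
  have hs : ∀ q, ContDiffOn ℝ ∞ (fun z => (G z)⁻¹ k q * lowerChristoffel G i j q z) W :=
    fun q => (hG.contDiffOn_inv k q).mul (hG.contDiffOn_lower i j q)
  rw [christoffel_eq_lower, pd_pd_const_mul hG.isOpen hG.mem (ContDiffOn.sum fun q _ => hs q),
    pd_pd_sum _ hG.isOpen hG.mem (fun q _ => hs q)]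
  congr 1
  have : ∀ q, pd l (pd p (fun z => (G z)⁻¹ k q * lowerChristoffel G i j q z)) y
      = (1 : Matrix (Fin m) (Fin m) ℝ) k q * pd l (pd p (lowerChristoffel G i j q)) y := by
    intro q
    rw [pd_pd_mul hG.isOpen hG.mem (hG.contDiffOn_inv k q) (hG.contDiffOn_lower i j q), hG.pd_inv,
      hG.pd_inv, hG.inv_eq, hG.lower_eq_zero]
    ring
  simp [this, Matrix.one_apply]

theorem SmoothMetricOn.contDiffOn_christoffel (hG : SmoothMetricOn G W) (k i j : Fin m) :
    ContDiffOn ℝ ∞ (christoffel G k i j) W :=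
  RHSoliton.contDiffOn_christoffel hG.isOpen hG.smooth hG.det_ne k i j

theorem NormalAt.ricci_eq (hG : NormalAt G W y) (j k : Fin m) :
    ricci G j k y = ∑ i, (pd i (christoffel G i j k) y - pd j (christoffel G i i k) y) := by
  simp [ricci, riemann, hG.christoffel_eq_zero]

/-- The ΓΓ terms of the curvature are products of two factors vanishing at the centre, so even their
first derivatives vanish. Only derivatives of ∂Γ remain. -/
theorem NormalAt.pd_ricci (hG : NormalAt G W y) (l j k : Fin m) :
    pd l (ricci G j k) y
      = ∑ i, (pd l (pd i (christoffel G i j k)) y - pd l (pd j (christoffel G i i k)) y) := by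
  have hΓ := hG.contDiffOn_christoffel
  have hd := fun a b c e => diffAt hG.isOpen hG.mem (contDiffOn_pd hG.isOpen (hΓ a b c) e)
  have hq : ∀ i p, ContDiffOn ℝ ∞ (fun z => christoffel G i i p z * christoffel G p j k z
      - christoffel G i j p z * christoffel G p i k z) W :=
    fun i p => ((hΓ _ _ _).mul (hΓ _ _ _)).sub ((hΓ _ _ _).mul (hΓ _ _ _))
  have h2 : ∀ a b c a' b' c', pd l (fun z => christoffel G a b c z * christoffel G a' b' c' z) y
      = 0 := by
    intro a b c a' b' c'
    rw [pd_mul (diffAt hG.isOpen hG.mem (hΓ _ _ _)) (diffAt hG.isOpen hG.mem (hΓ _ _ _)),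
      hG.christoffel_eq_zero, hG.christoffel_eq_zero]
    ring
  have hr : ∀ i, ContDiffOn ℝ ∞ (riemann G i i j k) W := fun i =>
    ((contDiffOn_pd hG.isOpen (hΓ _ _ _) _).sub (contDiffOn_pd hG.isOpen (hΓ _ _ _) _)).add
      (ContDiffOn.sum fun p _ => hq i p)
  unfold ricci
  rw [pd_sum _ (fun i _ => diffAt hG.isOpen hG.mem (hr i))]
  refine Finset.sum_congr rfl fun i _ => ?_
  unfold riemann
  rw [pd_add ((hd _ _ _ _).fun_sub (hd _ _ _ _))
      (diffAt hG.isOpen hG.mem (ContDiffOn.sum fun p _ => hq i p)),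
    pd_sub (hd _ _ _ _) (hd _ _ _ _), pd_sum _ (fun p _ => diffAt hG.isOpen hG.mem (hq i p))]
  have : ∀ p, pd l (fun z => christoffel G i i p z * christoffel G p j k z
      - christoffel G i j p z * christoffel G p i k z) y = 0 := by
    intro p
    rw [pd_sub, h2, h2, sub_zero]
    · exact diffAt hG.isOpen hG.mem ((hΓ _ _ _).mul (hΓ _ _ _))
    · exact diffAt hG.isOpen hG.mem ((hΓ _ _ _).mul (hΓ _ _ _))
  simp [this]

/-- Contracted second Bianchi identity at the centre of normal coordinates. -/
theorem NormalAt.contracted_bianchi (hG : NormalAt G W y) (i : Fin m) :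
    ∑ j, pd j (ricci G i j) y = (1 / 2) * ∑ j, pd i (ricci G j j) y := by
  have hs := fun a b c => contDiffOn_pd hG.isOpen (hG.smooth a b) c
  -- third derivatives of the metric
  let T : Fin m → Fin m → Fin m → Fin m → Fin m → ℝ :=
    fun a b c i j => pd a (pd b (pd c (fun z => G z i j))) y
  have hΓ : ∀ l p k i j, pd l (pd p (christoffel G k i j)) y
      = (1 / 2) * (T l p i j k + T l p j i k - T l p k i j) := by
    intro l p k i j
    rw [hG.pd_pd_christoffel]
    unfold lowerChristoffel
    rw [pd_pd_sub hG.isOpen hG.mem ((hs _ _ _).add (hs _ _ _)) (hs _ _ _),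
      pd_pd_add hG.isOpen hG.mem (hs _ _ _) (hs _ _ _)]
  have T1 : ∀ a b c i j, T a b c i j = T b a c i j :=
    fun a b c i j => pd_comm hG.isOpen hG.mem (hs i j c) a b
  have T2 : ∀ a b c i j, T a b c i j = T a c b i j := fun a b c i j =>
    pd_congr hG.isOpen hG.mem (fun z hz => pd_comm hG.isOpen hz (hG.smooth i j) b c) a
  have T3 : ∀ a b c i j, T a b c i j = T a b c j i := fun a b c i j =>
    pd_congr hG.isOpen hG.mem (fun z hz => pd_congr hG.isOpen hz (fun z hz =>
      pd_congr hG.isOpen hz (fun z hz => hG.symm z hz i j) c) b) a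
  simp only [hG.pd_ricci, hΓ]
  -- Both sides of the identity are reduced to the sum of `T i j q j q - T i j j q q`, which is ∂ᵢR
  -- at the centre; the divergence yields half of it.
  have e1 : ∑ j, ∑ q, (1 / 2 * (T j q i j q + T j q j i q - T j q q i j)
      - 1 / 2 * (T j i q j q + T j i j q q - T j i q q j))
      = ∑ j, ∑ q, (1 / 2 * T i j q j q - 1 / 2 * T i j j q q) := by
    -- These terms agree only after j and q are exchanged, hence as sums and not termwise.
    have s : ∑ j, ∑ q, T j q j i q = ∑ j, ∑ q, T j q q i j := by
      rw [Finset.sum_comm]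
      refine Finset.sum_congr rfl fun a _ => Finset.sum_congr rfl fun b _ => ?_
      rw [T1]
    have e : ∀ j q, (1 / 2 * (T j q i j q + T j q j i q - T j q q i j)
      - 1 / 2 * (T j i q j q + T j i j q q - T j i q q j))
      = (1 / 2 * T i j q j q - 1 / 2 * T i j j q q) + (1 / 2 * T j q j i q - 1 / 2 * T j q q i j) := by
      intro j q
      rw [T2 j q i j q, T1 j i q j q, T1 j i j q q, T1 j i q q j, T3 i j q q j]; ring
    simp only [e, Finset.sum_add_distrib, Finset.sum_sub_distrib, ← Finset.mul_sum, s]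
    ring
  have e2 : ∑ j, ∑ q, (1 / 2 * (T i q j j q + T i q j j q - T i q q j j)
      - 1 / 2 * (T i j q j q + T i j j q q - T i j q q j))
      = ∑ j, ∑ q, (T i j q j q - T i j j q q) := by
    have s : ∑ j, ∑ q, T i q q j j = ∑ j, ∑ q, T i j j q q := by
      rw [Finset.sum_comm]
    have e : ∀ j q, (1 / 2 * (T i q j j q + T i q j j q - T i q q j j)
      - 1 / 2 * (T i j q j q + T i j j q q - T i j q q j))
      = T i j q j q - 1 / 2 * T i q q j j - 1 / 2 * T i j j q q := by
      intro j q
      rw [T2 i q j, T3 i j q q j]; ring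
    simp only [e, Finset.sum_sub_distrib, ← Finset.mul_sum, s]
    ring
  rw [e1, e2, Finset.mul_sum]
  refine Finset.sum_congr rfl fun j _ => ?_
  rw [Finset.mul_sum]
  exact Finset.sum_congr rfl fun q _ => by ring

/-- `∂_l Γᵏᵢⱼ` at the centre of normal coordinates. -/
theorem NormalAt.pd_christoffel' (hG : NormalAt G W y) (l k i j : Fin m) :
    pd l (christoffel G k i j) y = (1 / 2) * (pd l (pd i (fun z => G z j k)) y
      + pd l (pd j (fun z => G z i k)) y - pd l (pd k (fun z => G z i j)) y) := by
  have hs := fun a b c => diffAt hG.isOpen hG.mem (contDiffOn_pd hG.isOpen (hG.smooth a b) c)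
  rw [hG.pd_christoffel]
  unfold lowerChristoffel
  rw [pd_sub ((hs _ _ _).fun_add (hs _ _ _)) (hs _ _ _), pd_add (hs _ _ _) (hs _ _ _)]

theorem NormalAt.hess_eq (hG : NormalAt G W y) (i j : Fin m) :
    hess G F i j y = pd i (pd j F) y := by
  simp [hess, hG.christoffel_eq_zero]

/-- The products Γ ∂∂F vanish at the centre; the surviving ∂Γ ∂F terms are the source of curvature
in the Ricci identity and in Bochner's formula. -/
theorem NormalAt.pd_hess (hG : NormalAt G W y) (hF : ContDiffOn ℝ ∞ F W) (l i j : Fin m) :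
    pd l (hess G F i j) y
      = pd l (pd i (pd j F)) y - ∑ k, pd l (christoffel G k i j) y * pd k F y := by
  have hΓ := hG.contDiffOn_christoffel
  have hF1 := fun k => contDiffOn_pd hG.isOpen hF k
  unfold hess
  rw [pd_sub (diffAt hG.isOpen hG.mem (contDiffOn_pd hG.isOpen (hF1 j) i))
    (diffAt hG.isOpen hG.mem (ContDiffOn.sum fun k _ => (hΓ k i j).mul (hF1 k))),
    pd_sum _ (fun k _ => diffAt hG.isOpen hG.mem ((hΓ k i j).mul (hF1 k)))]
  congr 1
  refine Finset.sum_congr rfl fun k _ => ?_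
  rw [pd_mul (diffAt hG.isOpen hG.mem (hΓ k i j)) (diffAt hG.isOpen hG.mem (hF1 k)),
    hG.christoffel_eq_zero]
  ring

/-- The Ricci identity, contracted, at the centre of normal coordinates. -/
theorem NormalAt.ricci_identity (hG : NormalAt G W y) (hF : ContDiffOn ℝ ∞ F W) (i : Fin m) :
    ∑ j, pd j (hess G F i j) y - ∑ j, pd i (hess G F j j) y = ∑ k, ricci G i k y * pd k F y := by
  let T : Fin m → Fin m → Fin m → Fin m → ℝ := fun b c i j => pd b (pd c (fun z => G z i j)) y
  have hΓ : ∀ l k i j, pd l (christoffel G k i j) y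
      = (1 / 2) * (T l i j k + T l j i k - T l k i j) := hG.pd_christoffel'
  have T2 : ∀ b c i j, T b c i j = T c b i j :=
    fun b c i j => pd_comm hG.isOpen hG.mem (hG.smooth i j) b c
  have T3 : ∀ b c i j, T b c i j = T b c j i := fun b c i j =>
    pd_congr hG.isOpen hG.mem (fun z hz =>
      pd_congr hG.isOpen hz (fun z hz => hG.symm z hz i j) c) b
  -- Third derivatives of F cancel in the difference, so only ∂Γ contracted with ∇F is left.
  have h3 : ∀ j, pd j (pd i (pd j F)) y = pd i (pd j (pd j F)) y := fun j =>
    pd_comm hG.isOpen hG.mem (contDiffOn_pd hG.isOpen hF j) j i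
  simp only [hG.pd_hess hF, hG.ricci_eq, hΓ, h3]
  rw [← Finset.sum_sub_distrib]
  simp only [sub_sub_sub_cancel_left, Finset.sum_mul]
  simp only [← Finset.sum_sub_distrib]
  rw [Finset.sum_comm]
  refine Finset.sum_congr rfl fun k _ => Finset.sum_congr rfl fun j _ => ?_
  rw [T2 j i j k, T3 i j k j, T2 j i k j, T2 j k i j, T3 i j j k]
  ring

theorem NormalAt.pd_metricTrace (hG : NormalAt G W y)
    {T : Fin m → Fin m → EuclideanSpace ℝ (Fin m) → ℝ}
    (hT : ∀ i j, ContDiffOn ℝ ∞ (T i j) W) (l : Fin m) :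
    pd l (fun z => metricTrace G (fun i j => T i j z) z) y = ∑ i, pd l (T i i) y := by
  have hs : ∀ i j, ContDiffOn ℝ ∞ (fun z => (G z)⁻¹ i j * T i j z) W :=
    fun i j => (hG.contDiffOn_inv i j).mul (hT i j)
  unfold metricTrace
  rw [pd_sum _ (fun i _ => diffAt hG.isOpen hG.mem (ContDiffOn.sum fun j _ => hs i j))]
  refine Finset.sum_congr rfl fun i _ => ?_
  rw [pd_sum _ (fun j _ => diffAt hG.isOpen hG.mem (hs i j))]
  have : ∀ j, pd l (fun z => (G z)⁻¹ i j * T i j z) y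
      = (1 : Matrix (Fin m) (Fin m) ℝ) i j * pd l (T i j) y := by
    intro j
    rw [pd_mul (diffAt hG.isOpen hG.mem (hG.contDiffOn_inv i j))
      (diffAt hG.isOpen hG.mem (hT i j)), hG.pd_inv, hG.inv_eq]
    ring
  simp [this, Matrix.one_apply]

theorem NormalAt.pd_pd_metricTrace (hG : NormalAt G W y)
    {T : Fin m → Fin m → EuclideanSpace ℝ (Fin m) → ℝ}
    (hT : ∀ i j, ContDiffOn ℝ ∞ (T i j) W) (l p : Fin m) :
    pd l (pd p (fun z => metricTrace G (fun i j => T i j z) z)) y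
      = ∑ i, pd l (pd p (T i i)) y - ∑ i, ∑ j, pd l (pd p (fun z => G z i j)) y * T i j y := by
  have hs : ∀ i j, ContDiffOn ℝ ∞ (fun z => (G z)⁻¹ i j * T i j z) W :=
    fun i j => (hG.contDiffOn_inv i j).mul (hT i j)
  unfold metricTrace
  rw [pd_pd_sum _ hG.isOpen hG.mem (fun i _ => ContDiffOn.sum fun j _ => hs i j),
    ← Finset.sum_sub_distrib]
  refine Finset.sum_congr rfl fun i _ => ?_
  rw [pd_pd_sum _ hG.isOpen hG.mem (fun j _ => hs i j)]
  have : ∀ j, pd l (pd p (fun z => (G z)⁻¹ i j * T i j z)) y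
      = (1 : Matrix (Fin m) (Fin m) ℝ) i j * pd l (pd p (T i j)) y
        - pd l (pd p (fun z => G z i j)) y * T i j y := by
    intro j
    rw [pd_pd_mul hG.isOpen hG.mem (hG.contDiffOn_inv i j) (hT i j), hG.pd_inv, hG.pd_inv,
      hG.inv_eq, hG.pd_pd_inv]
    ring
  simp [this, Matrix.one_apply, Finset.sum_sub_distrib]

theorem NormalAt.pd_gradInner_self (hG : NormalAt G W y) (hF : ContDiffOn ℝ ∞ F W) (l : Fin m) :
    pd l (gradInner G F F) y = 2 * ∑ i, pd l (pd i F) y * pd i F y := by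
  have h1 := fun i => contDiffOn_pd hG.isOpen hF i
  have := hG.pd_metricTrace (T := fun i j z => pd i F z * pd j F z)
    (fun i j => (h1 i).mul (h1 j)) l
  change pd l (gradInner G F F) y = _ at this
  rw [this, Finset.mul_sum]
  refine Finset.sum_congr rfl fun i _ => ?_
  rw [pd_mul (diffAt hG.isOpen hG.mem (h1 i)) (diffAt hG.isOpen hG.mem (h1 i))]
  ring

theorem NormalAt.pd_laplacian (hG : NormalAt G W y) (hF : ContDiffOn ℝ ∞ F W) (l : Fin m) :
    pd l (fun z => metricTrace G (fun i j => hess G F i j z) z) y = ∑ i, pd l (hess G F i i) y :=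
  hG.pd_metricTrace (fun i j => contDiffOn_hess hG.isOpen hG.smooth hG.det_ne hF i j) l

/-- Bochner's formula at the centre of normal coordinates. -/
theorem NormalAt.bochner (hG : NormalAt G W y) (hF : ContDiffOn ℝ ∞ F W) :
    ∑ k, pd k (pd k (gradInner G F F)) y
      = 2 * ∑ i, ∑ k, pd k (pd i F) y ^ 2 + 2 * ∑ i, pd i F y * ∑ k, pd i (hess G F k k) y
        + 2 * ∑ i, ∑ l, ricci G i l y * pd i F y * pd l F y := by
  have h1 := fun i => contDiffOn_pd hG.isOpen hF i
  let T : Fin m → Fin m → Fin m → Fin m → ℝ := fun b c i j => pd b (pd c (fun z => G z i j)) y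
  have hΓ : ∀ l k i j, pd l (christoffel G k i j) y
      = (1 / 2) * (T l i j k + T l j i k - T l k i j) := hG.pd_christoffel'
  have T2 : ∀ b c i j, T b c i j = T c b i j :=
    fun b c i j => pd_comm hG.isOpen hG.mem (hG.smooth i j) b c
  have T3 : ∀ b c i j, T b c i j = T b c j i := fun b c i j =>
    pd_congr hG.isOpen hG.mem (fun z hz =>
      pd_congr hG.isOpen hz (fun z hz => hG.symm z hz i j) c) b
  have h3 : ∀ i k, pd k (pd k (pd i F)) y = pd i (pd k (pd k F)) y := fun i k => by
    rw [← pd_comm hG.isOpen hG.mem (h1 k) k i]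
    exact pd_congr hG.isOpen hG.mem (fun z hz => pd_comm hG.isOpen hz hF k i) k
  -- The metric is flat only to first order: the second derivatives of g⁻¹ contribute minus those of
  -- g, which is the last sum.
  have hL : ∀ k, pd k (pd k (gradInner G F F)) y
      = ∑ i, (2 * (pd i F y * pd i (pd k (pd k F)) y) + 2 * pd k (pd i F) y ^ 2)
        - ∑ i, ∑ j, T k k i j * (pd i F y * pd j F y) := by
    intro k
    have := hG.pd_pd_metricTrace (T := fun i j z => pd i F z * pd j F z)
      (fun i j => (h1 i).mul (h1 j)) k k
    change pd k (pd k (gradInner G F F)) y = _ at this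
    rw [this]
    congr 1
    refine Finset.sum_congr rfl fun i _ => ?_
    rw [pd_pd_mul hG.isOpen hG.mem (h1 i) (h1 i), h3]
    ring
  have hR : ∀ i, ∑ l, ricci G i l y * pd i F y * pd l F y
      = ∑ k, ∑ l, (pd k (christoffel G k i l) y - pd i (christoffel G k k l) y)
        * pd i F y * pd l F y := by
    intro i
    simp only [hG.ricci_eq, Finset.sum_mul]
    exact Finset.sum_comm
  simp only [hL, hR, hG.pd_hess hF, hΓ, Finset.mul_sum, ← Finset.sum_add_distrib,
    ← Finset.sum_sub_distrib, mul_sub]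
  conv_rhs => rw [Finset.sum_comm]
  refine Finset.sum_congr rfl fun k _ => ?_
  -- The weight ∂ᵢF ∂ₗF is symmetric, so these terms match after i and l are exchanged, though not
  -- termwise.
  have s : ∑ i, ∑ l, T k l i k * (pd i F y * pd l F y)
      = ∑ i, ∑ l, T k i k l * (pd i F y * pd l F y) := by
    rw [Finset.sum_comm]
    refine Finset.sum_congr rfl fun i _ => Finset.sum_congr rfl fun l _ => ?_
    rw [T3 k i k l]; ring
  have e : ∀ i l, T k k i l * (pd i F y * pd l F y)
      = 2 * (pd i F y * (1 / 2 * (T i k k l + T i k k l - T i l k k) * pd l F y))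
       - 2 * ((1 / 2 * (T k i l k + T k l i k - T k k i l)
        - 1 / 2 * (T i k l k + T i l k k - T i k k l)) * pd i F y * pd l F y)
       + T k l i k * (pd i F y * pd l F y) - T k i k l * (pd i F y * pd l F y) := by
    intro i l
    rw [T3 i k l k, T2 i k k l, T3 k i l k]
    ring
  simp only [e, Finset.sum_sub_distrib, Finset.sum_add_distrib, s]
  ring_nf

/-- If `Rc - α P + Hess F = c g` and `div P - ½ d (tr P) = P(∇F)` at the centre of normal
coordinates, then `ΔF - |∇F|² + 2 c F` is critical there. -/
theorem NormalAt.pd_hamilton_eq_zero (hG : NormalAt G W y) (hF : ContDiffOn ℝ ∞ F W)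
    {P : Fin m → Fin m → EuclideanSpace ℝ (Fin m) → ℝ} (hP : ∀ i j, ContDiffOn ℝ ∞ (P i j) W)
    {α c : ℝ}
    (hsol : ∀ z ∈ W, ∀ i j, ricci G i j z - α * P i j z + hess G F i j z = c * G z i j)
    (hdiv : ∀ i, ∑ j, pd j (P i j) y - (1 / 2) * ∑ j, pd i (P j j) y
      = ∑ k, P i k y * pd k F y) (i : Fin m) :
    pd i (fun z => metricTrace G (fun i j => hess G F i j z) z - gradInner G F F z
      + 2 * c * F z) y = 0 := by
  have hR := contDiffOn_ricci hG.isOpen hG.smooth hG.det_ne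
  have hH := contDiffOn_hess hG.isOpen hG.smooth hG.det_ne hF
  have dA := fun {K : EuclideanSpace ℝ (Fin m) → ℝ} (hK : ContDiffOn ℝ ∞ K W) =>
    diffAt hG.isOpen hG.mem hK
  have hL : ContDiffOn ℝ ∞ (fun z => metricTrace G (fun i j => hess G F i j z) z) W :=
    contDiffOn_metricTrace hG.smooth hG.det_ne hH
  have hN := contDiffOn_gradInner hG.isOpen hG.smooth hG.det_ne hF hF
  rw [pd_add ((dA hL).fun_sub (dA hN)) (dA (contDiffOn_const.mul hF)), pd_sub (dA hL) (dA hN),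
    pd_const_mul (dA hF), hG.pd_laplacian hF, hG.pd_gradInner_self hF]
  -- The right-hand side c g differentiates to zero because c is constant and ∂g = 0 at the centre.
  have hd : ∀ l a b, pd l (ricci G a b) y - α * pd l (P a b) y + pd l (hess G F a b) y = 0 := by
    intro l a b
    have := pd_congr hG.isOpen hG.mem (fun z hz => hsol z hz a b) l
    rw [pd_const_mul (dA (hG.smooth a b)), hG.pd_eq_zero, mul_zero,
      pd_add ((dA (hR a b)).fun_sub (dA (contDiffOn_const.mul (hP a b)))) (dA (hH a b)),
      pd_sub (dA (hR a b)) (dA (contDiffOn_const.mul (hP a b))), pd_const_mul (dA (hP a b))] at this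
    exact this
  have s1 : ∑ j, pd j (ricci G i j) y - α * ∑ j, pd j (P i j) y + ∑ j, pd j (hess G F i j) y
      = 0 := by
    rw [Finset.mul_sum, ← Finset.sum_sub_distrib, ← Finset.sum_add_distrib]
    exact Finset.sum_eq_zero fun j _ => hd j i j
  have s2 : ∑ j, pd i (ricci G j j) y - α * ∑ j, pd i (P j j) y + ∑ j, pd i (hess G F j j) y
      = 0 := by
    rw [Finset.mul_sum, ← Finset.sum_sub_distrib, ← Finset.sum_add_distrib]
    exact Finset.sum_eq_zero fun j _ => hd i j j
  have s3 := hG.contracted_bianchi i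
  have s4 := hdiv i
  have s5 := hG.ricci_identity hF i
  have s6 : ∑ k, ricci G i k y * pd k F y - α * ∑ k, P i k y * pd k F y
      + ∑ k, pd i (pd k F) y * pd k F y = c * pd i F y := by
    have : ∀ k, ricci G i k y * pd k F y - α * (P i k y * pd k F y) + pd i (pd k F) y * pd k F y
        = c * ((1 : Matrix (Fin m) (Fin m) ℝ) i k * pd k F y) := by
      intro k
      have := hsol y hG.mem i k
      rw [hG.hess_eq, hG.eq_one] at this
      linear_combination pd k F y * this
    rw [Finset.mul_sum, ← Finset.sum_sub_distrib, ← Finset.sum_add_distrib,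
      Finset.sum_congr rfl fun k _ => this k, ← Finset.mul_sum]
    simp [Matrix.one_apply]
  -- `2 * s1 - s2` is twice the divergence minus the differential of the trace. Bianchi, the map
  -- identity and the Ricci identity rewrite its three parts, and `s6`, the soliton equation
  -- contracted with ∇F, eliminates Rc and P.
  linear_combination 2 * s1 - s2 - 2 * s3 + 2 * α * s4 - 2 * s5 - 2 * s6

end Normal

/-! Pullback of local metrics and change of coordinates. -/

section Pullback

variable {m n : ℕ} {H : EuclideanSpace ℝ (Fin n) → Matrix (Fin n) (Fin n) ℝ}
  {V : Set (EuclideanSpace ℝ (Fin n))} {W : Set (EuclideanSpace ℝ (Fin m))}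
  {U : EuclideanSpace ℝ (Fin m) → EuclideanSpace ℝ (Fin n)} {y : EuclideanSpace ℝ (Fin m)}
  {K : EuclideanSpace ℝ (Fin n) → ℝ}

/-- Components `h(∂ᵢU, ∂ⱼU)` of the pullback by `U` of the metric with matrix `H`. -/
def pullbackMatrix (H : EuclideanSpace ℝ (Fin n) → Matrix (Fin n) (Fin n) ℝ)
    (U : EuclideanSpace ℝ (Fin m) → EuclideanSpace ℝ (Fin n)) (i j : Fin m)
    (y : EuclideanSpace ℝ (Fin m)) : ℝ :=
  ∑ a, ∑ b, H (U y) a b * (pd i (fun z => U z a) y * pd j (fun z => U z b) y)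

theorem contDiffOn_coord (hU : ContDiffOn ℝ ∞ U W) (a : Fin n) :
    ContDiffOn ℝ ∞ (fun z => U z a) W :=
  (EuclideanSpace.proj a : EuclideanSpace ℝ (Fin n) →L[ℝ] ℝ).contDiff.comp_contDiffOn hU

theorem pd_comp_of_contDiffOn (hW : IsOpen W) (hV : IsOpen V) (hU : ContDiffOn ℝ ∞ U W)
    (hm : Set.MapsTo U W V) (hK : ContDiffOn ℝ ∞ K V) (hy : y ∈ W) (i : Fin m) :
    pd i (fun z => K (U z)) y = ∑ a, pd a K (U y) * pd i (fun z => U z a) y :=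
  pd_comp (diffAt hV (hm hy) hK)
    ((hU.contDiffAt (hW.mem_nhds hy)).differentiableAt (by simp)) i

theorem contDiffOn_pullbackMatrix (hH : SmoothMetricOn H V) (hW : IsOpen W)
    (hU : ContDiffOn ℝ ∞ U W) (hm : Set.MapsTo U W V) (i j : Fin m) :
    ContDiffOn ℝ ∞ (pullbackMatrix H U i j) W :=
  ContDiffOn.sum fun a _ => ContDiffOn.sum fun b _ => ((hH.smooth a b).comp hU hm).mul
    ((contDiffOn_pd hW (contDiffOn_coord hU a) i).mul (contDiffOn_pd hW (contDiffOn_coord hU b) j))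

/-- Derivative of a pulled back metric. -/
theorem pd_pullbackMatrix (hH : SmoothMetricOn H V) (hW : IsOpen W)
    (hU : ContDiffOn ℝ ∞ U W) (hm : Set.MapsTo U W V) (hy : y ∈ W) (k i j : Fin m) :
    pd k (pullbackMatrix H U i j) y
      = ∑ a, ∑ b, H (U y) a b * (pd k (pd i (fun z => U z a)) y * pd j (fun z => U z b) y)
      + ∑ a, ∑ b, H (U y) a b * (pd k (pd j (fun z => U z a)) y * pd i (fun z => U z b) y)
      + ∑ c, ∑ a, ∑ b, pd k (fun z => U z c) y * pd i (fun z => U z a) y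
          * pd j (fun z => U z b) y * pd c (fun z => H z a b) (U y) := by
  have hUc := contDiffOn_coord hU
  have hUd := fun a i => contDiffOn_pd hW (hUc a) i
  have hHc : ∀ a b, ContDiffOn ℝ ∞ (fun z => H (U z) a b) W :=
    fun a b => (hH.smooth a b).comp hU hm
  have hs : ∀ a b, ContDiffOn ℝ ∞ (fun z => H (U z) a b *
      (pd i (fun z => U z a) z * pd j (fun z => U z b) z)) W :=
    fun a b => (hHc a b).mul ((hUd a i).mul (hUd b j))
  have h1 : pd k (pullbackMatrix H U i j) y
      = ∑ a, ∑ b, (H (U y) a b * (pd k (pd i (fun z => U z a)) y * pd j (fun z => U z b) y)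
        + H (U y) a b * (pd k (pd j (fun z => U z b)) y * pd i (fun z => U z a) y)
        + ∑ c, pd k (fun z => U z c) y * pd i (fun z => U z a) y
          * pd j (fun z => U z b) y * pd c (fun z => H z a b) (U y)) := by
    unfold pullbackMatrix
    rw [pd_sum _ (fun a _ => diffAt hW hy (ContDiffOn.sum fun b _ => hs a b))]
    refine Finset.sum_congr rfl fun a _ => ?_
    rw [pd_sum _ (fun b _ => diffAt hW hy (hs a b))]
    refine Finset.sum_congr rfl fun b _ => ?_
    rw [pd_mul (diffAt hW hy (hHc a b)) (diffAt hW hy ((hUd a i).mul (hUd b j))),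
      pd_mul (diffAt hW hy (hUd a i)) (diffAt hW hy (hUd b j)),
      pd_comp_of_contDiffOn hW hH.isOpen hU hm (hH.smooth a b) hy, Finset.sum_mul]
    rw [add_comm]
    congr 1
    · ring
    · exact Finset.sum_congr rfl fun c _ => by ring
  rw [h1]
  simp only [Finset.sum_add_distrib]
  congr 1
  · congr 1
    rw [Finset.sum_comm]
    refine Finset.sum_congr rfl fun a _ => Finset.sum_congr rfl fun b _ => ?_
    rw [hH.symm _ (hm hy) b a]
  · conv_rhs => rw [Finset.sum_comm]
    exact Finset.sum_congr rfl fun a _ => Finset.sum_comm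

/-- `div (u^*h) - ½ d (tr u^*h) = h(τ, du)` in normal coordinates, with `τ = du(∇f)`. -/
theorem NormalAt.div_pullbackMatrix (hH : NormalAt H V (U y)) (hW : IsOpen W)
    (hU : ContDiffOn ℝ ∞ U W) (hm : Set.MapsTo U W V) (hy : y ∈ W)
    {F : EuclideanSpace ℝ (Fin m) → ℝ}
    (hτ : ∀ c, ∑ j, pd j (pd j (fun z => U z c)) y = ∑ k, pd k (fun z => U z c) y * pd k F y)
    (i : Fin m) :
    ∑ j, pd j (pullbackMatrix H U i j) y - (1 / 2) * ∑ j, pd i (pullbackMatrix H U j j) y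
      = ∑ k, pullbackMatrix H U i k y * pd k F y := by
  have h1 : ∀ l i j, pd l (pullbackMatrix H U i j) y
      = ∑ a, pd l (pd i (fun z => U z a)) y * pd j (fun z => U z a) y
      + ∑ a, pd l (pd j (fun z => U z a)) y * pd i (fun z => U z a) y := by
    intro l i j
    rw [pd_pullbackMatrix hH.toSmoothMetricOn hW hU hm hy]
    simp [hH.pd_eq_zero, hH.eq_one, Matrix.one_apply]
  have h2 : ∀ i j, pullbackMatrix H U i j y
      = ∑ a, pd i (fun z => U z a) y * pd j (fun z => U z a) y := by
    intro i j
    simp [pullbackMatrix, hH.eq_one, Matrix.one_apply]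
  have hc : ∀ i j a, pd i (pd j (fun z => U z a)) y = pd j (pd i (fun z => U z a)) y :=
    fun i j a => pd_comm hW hy (contDiffOn_coord hU a) i j
  simp only [h1, h2, Finset.sum_add_distrib]
  -- This part of the divergence is exactly half the differential of the trace, so it cancels and
  -- only the tension term `e2` remains.
  have e1 : ∑ j, ∑ a, pd j (pd i (fun z => U z a)) y * pd j (fun z => U z a) y
      = ∑ j, ∑ a, pd i (pd j (fun z => U z a)) y * pd j (fun z => U z a) y :=
    Finset.sum_congr rfl fun j _ => Finset.sum_congr rfl fun a _ => by rw [hc]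
  have e2 : ∑ j, ∑ a, pd j (pd j (fun z => U z a)) y * pd i (fun z => U z a) y
      = ∑ k, (∑ a, pd i (fun z => U z a) y * pd k (fun z => U z a) y) * pd k F y := by
    simp only [Finset.sum_mul]
    rw [Finset.sum_comm]
    conv_rhs => rw [Finset.sum_comm]
    refine Finset.sum_congr rfl fun a _ => ?_
    rw [← Finset.sum_mul, hτ, Finset.sum_mul]
    exact Finset.sum_congr rfl fun k _ => by ring
  rw [e1, e2]
  ring

end Pullback

/-! ### Behaviour of metric traces, gradients and Hessians under changes of coordinates. -/

section Change

variable {m : ℕ} {G G' : EuclideanSpace ℝ (Fin m) → Matrix (Fin m) (Fin m) ℝ}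
  {V W : Set (EuclideanSpace ℝ (Fin m))}
  {φ : EuclideanSpace ℝ (Fin m) → EuclideanSpace ℝ (Fin m)} {y : EuclideanSpace ℝ (Fin m)}
  {F K : EuclideanSpace ℝ (Fin m) → ℝ}

/-- `φ` is a change of coordinates under which the metric `G` becomes `G'`. -/
structure IsChange (G : EuclideanSpace ℝ (Fin m) → Matrix (Fin m) (Fin m) ℝ)
    (G' : EuclideanSpace ℝ (Fin m) → Matrix (Fin m) (Fin m) ℝ)
    (V W : Set (EuclideanSpace ℝ (Fin m)))
    (φ : EuclideanSpace ℝ (Fin m) → EuclideanSpace ℝ (Fin m)) : Prop where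
  left : SmoothMetricOn G V
  right : SmoothMetricOn G' W
  smooth : ContDiffOn ℝ ∞ φ W
  mapsTo : Set.MapsTo φ W V
  eq : ∀ z ∈ W, ∀ i j, G' z i j = pullbackMatrix G φ i j z

theorem IsChange.inv_eq (h : IsChange G G' V W φ) (hy : y ∈ W) (a b : Fin m) :
    ∑ i, ∑ j, (G' y)⁻¹ i j * (pd i (fun z => φ z a) y * pd j (fun z => φ z b) y)
      = (G (φ y))⁻¹ a b := by
  let J : Matrix (Fin m) (Fin m) ℝ := Matrix.of fun a i => pd i (fun z => φ z a) y
  have hGJ : G' y = J.transpose * G (φ y) * J := by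
    ext i j
    rw [h.eq y hy, pullbackMatrix]
    simp only [Matrix.mul_apply, Matrix.transpose_apply, J, Matrix.of_apply, Finset.sum_mul]
    rw [Finset.sum_comm]
    exact Finset.sum_congr rfl fun a _ => Finset.sum_congr rfl fun b _ => by ring
  have hd := h.right.det_ne y hy
  -- Invertibility of the Jacobian comes from nondegeneracy of the pulled back metric; no inverse of
  -- φ is needed.
  have hJ : J.det ≠ 0 := by
    intro h0; apply hd; rw [hGJ, Matrix.det_mul, h0, mul_zero]
  have hJu : IsUnit J.det := isUnit_iff_ne_zero.mpr hJ
  have hJt : IsUnit J.transpose.det := by rw [Matrix.det_transpose]; exact hJu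
  have key : J * (G' y)⁻¹ * J.transpose = (G (φ y))⁻¹ := by
    rw [hGJ, Matrix.mul_inv_rev, Matrix.mul_inv_rev, ← Matrix.mul_assoc, ← Matrix.mul_assoc,
      Matrix.mul_nonsing_inv _ hJu, Matrix.one_mul, Matrix.mul_assoc,
      Matrix.nonsing_inv_mul _ hJt, Matrix.mul_one]
  rw [← key]
  simp only [Matrix.mul_apply, Matrix.transpose_apply, J, Matrix.of_apply, Finset.sum_mul]
  rw [Finset.sum_comm]
  exact Finset.sum_congr rfl fun a _ => Finset.sum_congr rfl fun b _ => by ring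

theorem IsChange.metricTrace_eq (h : IsChange G G' V W φ) (hy : y ∈ W) (T : Fin m → Fin m → ℝ) :
    metricTrace G' (fun i j => ∑ a, ∑ b, pd i (fun z => φ z a) y * pd j (fun z => φ z b) y * T a b) y
      = metricTrace G T (φ y) := by
  unfold metricTrace
  simp only [← h.inv_eq hy, Finset.mul_sum, Finset.sum_mul]
  calc _ = ∑ i, ∑ a, ∑ j, ∑ b, (G' y)⁻¹ i j *
        (pd i (fun z => φ z a) y * pd j (fun z => φ z b) y * T a b) :=
        Finset.sum_congr rfl fun i _ => Finset.sum_comm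
    _ = ∑ a, ∑ i, ∑ b, ∑ j, (G' y)⁻¹ i j *
        (pd i (fun z => φ z a) y * pd j (fun z => φ z b) y * T a b) := by
        rw [Finset.sum_comm]
        exact Finset.sum_congr rfl fun a _ => Finset.sum_congr rfl fun i _ => Finset.sum_comm
    _ = _ := by
        refine Finset.sum_congr rfl fun a _ => ?_
        rw [Finset.sum_comm]
        refine Finset.sum_congr rfl fun b _ => Finset.sum_congr rfl fun i _ =>
          Finset.sum_congr rfl fun j _ => by ring

theorem IsChange.pd_comp (h : IsChange G G' V W φ) (hy : y ∈ W) (hF : ContDiffOn ℝ ∞ F V)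
    (i : Fin m) : pd i (fun z => F (φ z)) y = ∑ a, pd a F (φ y) * pd i (fun z => φ z a) y :=
  pd_comp_of_contDiffOn h.right.isOpen h.left.isOpen h.smooth h.mapsTo hF hy i

theorem IsChange.gradInner_eq (h : IsChange G G' V W φ) (hy : y ∈ W) (hF : ContDiffOn ℝ ∞ F V)
    (hK : ContDiffOn ℝ ∞ K V) :
    gradInner G' (fun z => F (φ z)) (fun z => K (φ z)) y = gradInner G F K (φ y) := by
  unfold gradInner
  rw [← h.metricTrace_eq hy]
  congr 1
  ext i j
  rw [h.pd_comp hy hF, h.pd_comp hy hK, Finset.sum_mul_sum]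
  exact Finset.sum_congr rfl fun a _ => Finset.sum_congr rfl fun b _ => by ring

/-- Differentiating the pulled back metric gives six sums in second derivatives of φ. Since partial
derivatives commute, four cancel and the other two coincide: this is the non-tensorial term. -/
theorem IsChange.lower_eq (h : IsChange G G' V W φ) (hy : y ∈ W) (i j l : Fin m) :
    lowerChristoffel G' i j l y
      = 2 * ∑ a, ∑ b, G (φ y) a b * (pd i (pd j (fun z => φ z a)) y * pd l (fun z => φ z b) y)
      + ∑ a, ∑ b, ∑ c, pd i (fun z => φ z a) y * pd j (fun z => φ z b) y * pd l (fun z => φ z c) y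
        * lowerChristoffel G a b c (φ y) := by
  have hd : ∀ k i j, pd k (fun z => G' z i j) y = pd k (pullbackMatrix G φ i j) y :=
    fun k i j => pd_congr h.right.isOpen hy (fun z hz => h.eq z hz i j) k
  have hc : ∀ i j a, pd i (pd j (fun z => φ z a)) y = pd j (pd i (fun z => φ z a)) y :=
    fun i j a => pd_comm h.right.isOpen hy (contDiffOn_coord h.smooth a) i j
  unfold lowerChristoffel
  simp only [hd, pd_pullbackMatrix h.left h.right.isOpen h.smooth h.mapsTo hy, mul_sub, mul_add,
    Finset.sum_sub_distrib, Finset.sum_add_distrib, hc j i, hc l i, hc l j]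
  have e1 : ∑ c, ∑ a, ∑ b, pd j (fun z => φ z c) y * pd i (fun z => φ z a) y
          * pd l (fun z => φ z b) y * pd c (fun z => G z a b) (φ y)
      = ∑ a, ∑ b, ∑ c, pd i (fun z => φ z a) y * pd j (fun z => φ z b) y
          * pd l (fun z => φ z c) y * pd b (fun z => G z a c) (φ y) := by
    rw [Finset.sum_comm]
    exact Finset.sum_congr rfl fun a _ => Finset.sum_congr rfl fun b _ =>
      Finset.sum_congr rfl fun c _ => by ring
  have e2 : ∑ c, ∑ a, ∑ b, pd l (fun z => φ z c) y * pd i (fun z => φ z a) y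
          * pd j (fun z => φ z b) y * pd c (fun z => G z a b) (φ y)
      = ∑ a, ∑ b, ∑ c, pd i (fun z => φ z a) y * pd j (fun z => φ z b) y
          * pd l (fun z => φ z c) y * pd c (fun z => G z a b) (φ y) := by
    rw [Finset.sum_comm]
    refine Finset.sum_congr rfl fun a _ => ?_
    rw [Finset.sum_comm]
    exact Finset.sum_congr rfl fun b _ => Finset.sum_congr rfl fun c _ => by ring
  rw [e1, e2]
  ring

/-- The Hessian in terms of the gradient and the Christoffel symbols of the first kind. -/
theorem hess_eq_lower (i j : Fin m) : hess G F i j y = pd i (pd j F) y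
    - (1 / 2) * ∑ l, (∑ k, pd k F y * (G y)⁻¹ k l) * lowerChristoffel G i j l y := by
  unfold hess
  congr 1
  simp only [christoffel_eq_lower, Finset.sum_mul, Finset.mul_sum]
  rw [Finset.sum_comm]
  exact Finset.sum_congr rfl fun a _ => Finset.sum_congr rfl fun b _ => by ring

/-- The second derivatives of φ produced by the chain rule cancel the non-tensorial part of the
Christoffel symbols, leaving a (0,2)-tensor. -/
theorem IsChange.hess_eq (h : IsChange G G' V W φ) (hy : y ∈ W) (hF : ContDiffOn ℝ ∞ F V)
    (i j : Fin m) : hess G' (fun z => F (φ z)) i j y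
      = ∑ a, ∑ b, pd i (fun z => φ z a) y * pd j (fun z => φ z b) y * hess G F a b (φ y) := by
  have hφc := contDiffOn_coord h.smooth
  have hφd := fun a i => contDiffOn_pd h.right.isOpen (hφc a) i
  let c : Fin m → ℝ := fun l => ∑ k, pd k F (φ y) * (G (φ y))⁻¹ k l
  let c' : Fin m → ℝ := fun l => ∑ k, pd k (fun z => F (φ z)) y * (G' y)⁻¹ k l
  -- The differential of φ sends the gradient of F ∘ φ to the gradient of F.
  have hcc : ∀ d, ∑ l, c' l * pd l (fun z => φ z d) y = c d := by
    intro d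
    simp only [c, c', h.pd_comp hy hF, ← h.inv_eq hy, Finset.sum_mul, Finset.mul_sum]
    rw [Finset.sum_comm]
    calc _ = ∑ k, ∑ a, ∑ l, pd a F (φ y) * pd k (fun z => φ z a) y * (G' y)⁻¹ k l
            * pd l (fun z => φ z d) y := Finset.sum_congr rfl fun k _ => Finset.sum_comm
      _ = _ := by
        rw [Finset.sum_comm]
        exact Finset.sum_congr rfl fun a _ => Finset.sum_congr rfl fun b _ =>
          Finset.sum_congr rfl fun c _ => by ring
  have hGc : ∀ a, ∑ b, G (φ y) a b * c b = pd a F (φ y) := by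
    intro a
    simp only [c, Finset.mul_sum]
    rw [Finset.sum_comm]
    have : ∀ k, ∑ b, G (φ y) a b * (pd k F (φ y) * (G (φ y))⁻¹ k b)
        = pd k F (φ y) * (1 : Matrix (Fin m) (Fin m) ℝ) k a := by
      intro k
      rw [← h.left.sum_inv_mul (h.mapsTo hy) k a, Finset.mul_sum]
      exact Finset.sum_congr rfl fun b _ => by rw [h.left.symm _ (h.mapsTo hy) a b]; ring
    simp [this, Matrix.one_apply]
  have hs : ∀ a, ContDiffOn ℝ ∞ (fun z => pd a F (φ z)) W :=
    fun a => (contDiffOn_pd h.left.isOpen hF a).comp h.smooth h.mapsTo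
  have h2 : pd i (pd j (fun z => F (φ z))) y
      = ∑ a, pd a F (φ y) * pd i (pd j (fun z => φ z a)) y
      + ∑ a, ∑ b, pd i (fun z => φ z a) y * pd j (fun z => φ z b) y * pd a (pd b F) (φ y) := by
    rw [pd_congr h.right.isOpen hy (fun z hz => h.pd_comp hz hF j) i,
      pd_sum _ (fun a _ => diffAt h.right.isOpen hy ((hs a).mul (hφd a j)))]
    conv_rhs => rw [Finset.sum_comm, ← Finset.sum_add_distrib]
    refine Finset.sum_congr rfl fun b _ => ?_
    rw [pd_mul (diffAt h.right.isOpen hy (hs b)) (diffAt h.right.isOpen hy (hφd b j)),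
      h.pd_comp hy (contDiffOn_pd h.left.isOpen hF b), Finset.sum_mul, add_comm]
    congr 1
    exact Finset.sum_congr rfl fun a _ => by ring
  have h3 : ∑ l, c' l * lowerChristoffel G' i j l y
      = 2 * ∑ a, pd a F (φ y) * pd i (pd j (fun z => φ z a)) y
        + ∑ a, ∑ b, pd i (fun z => φ z a) y * pd j (fun z => φ z b) y *
          ∑ d, c d * lowerChristoffel G a b d (φ y) := by
    simp only [h.lower_eq hy, mul_add, Finset.sum_add_distrib]
    congr 1
    · simp only [← hGc, ← hcc, Finset.mul_sum, Finset.sum_mul]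
      rw [Finset.sum_comm]
      refine Finset.sum_congr rfl fun a _ => ?_
      rw [Finset.sum_comm]
      exact Finset.sum_congr rfl fun a _ => Finset.sum_congr rfl fun b _ => by ring
    · simp only [← hcc, Finset.mul_sum, Finset.sum_mul]
      rw [Finset.sum_comm]
      refine Finset.sum_congr rfl fun a _ => ?_
      rw [Finset.sum_comm]
      refine Finset.sum_congr rfl fun b _ => ?_
      rw [Finset.sum_comm]
      exact Finset.sum_congr rfl fun a _ => Finset.sum_congr rfl fun b _ => by ring
  rw [hess_eq_lower, h2, h3]
  simp only [hess_eq_lower, mul_sub, Finset.sum_sub_distrib]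
  have e : ∑ a, ∑ b, pd i (fun z => φ z a) y * pd j (fun z => φ z b) y *
      ((1 / 2) * ∑ d, c d * lowerChristoffel G a b d (φ y))
      = (1 / 2) * ∑ a, ∑ b, pd i (fun z => φ z a) y * pd j (fun z => φ z b) y *
      ∑ d, c d * lowerChristoffel G a b d (φ y) := by
    simp only [Finset.mul_sum]
    exact Finset.sum_congr rfl fun a _ => Finset.sum_congr rfl fun b _ =>
      Finset.sum_congr rfl fun d _ => by ring
  rw [e]
  ring

theorem IsChange.laplacian_eq (h : IsChange G G' V W φ) (hy : y ∈ W) (hF : ContDiffOn ℝ ∞ F V) :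
    metricTrace G' (fun i j => hess G' (fun z => F (φ z)) i j y) y
      = metricTrace G (fun i j => hess G F i j (φ y)) (φ y) := by
  simp only [h.hess_eq hy hF, h.metricTrace_eq hy]

end Change

/-! Maximum principles in local coordinates. -/

section MaximumPrinciple

variable {m : ℕ} {W : Set (EuclideanSpace ℝ (Fin m))} {y : EuclideanSpace ℝ (Fin m)}
  {F K : EuclideanSpace ℝ (Fin m) → ℝ}

theorem pd_eq_zero_of_isLocalMin (h : IsLocalMin F y) (i : Fin m) : pd i F y = 0 := by
  simp [pd, h.fderiv_eq_zero]

theorem hessian_nonneg_of_isLocalMin (hW : IsOpen W) (hy : y ∈ W) (hF : ContDiffOn ℝ ∞ F W)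
    (h : IsLocalMin F y) (v : Fin m → ℝ) : 0 ≤ ∑ i, ∑ j, v i * v j * pd i (pd j F) y := by
  by_contra! hneg
  let w : EuclideanSpace ℝ (Fin m) := WithLp.toLp 2 v
  have hline : ∀ t : ℝ, HasDerivAt (fun t : ℝ => y + t • w) w t := fun t => by
    simpa using ((hasDerivAt_id t).smul_const w).const_add y
  have h0 : y + (0 : ℝ) • w = y := by simp
  have hcont : Continuous fun t : ℝ => y + t • w := by fun_prop
  have hev : ∀ᶠ t : ℝ in 𝓝 0, y + t • w ∈ W :=
    hcont.continuousAt.preimage_mem_nhds (by rw [h0]; exact hW.mem_nhds hy)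
  have hder : ∀ {K : EuclideanSpace ℝ (Fin m) → ℝ} {t : ℝ}, DifferentiableAt ℝ K (y + t • w) →
      deriv (fun t : ℝ => K (y + t • w)) t = ∑ i, v i * pd i K (y + t • w) := by
    intro K t hK
    rw [← fderiv_eq_sum_pd (v := w)]
    exact (hK.hasFDerivAt.comp_hasDerivAt t (hline t)).deriv
  have hd1 : deriv (fun t : ℝ => F (y + t • w)) =ᶠ[𝓝 0]
      fun t => ∑ i, v i * pd i F (y + t • w) :=
    hev.mono fun t ht => hder (diffAt hW ht hF)
  have hd2 : deriv (deriv (fun t : ℝ => F (y + t • w))) 0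
      = ∑ i, ∑ j, v i * v j * pd i (pd j F) y := by
    have hsm : ContDiffOn ℝ ∞ (fun z => ∑ i, v i * pd i F z) W :=
      ContDiffOn.sum fun i _ => contDiffOn_const.mul (contDiffOn_pd hW hF i)
    rw [hd1.deriv_eq, hder (K := fun z => ∑ i, v i * pd i F z)
      (by rw [h0]; exact diffAt hW hy hsm), h0]
    refine Finset.sum_congr rfl fun i _ => ?_
    rw [pd_sum _ (fun j _ => diffAt hW hy (contDiffOn_const.mul (contDiffOn_pd hW hF j))),
      Finset.mul_sum]
    refine Finset.sum_congr rfl fun j _ => ?_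
    rw [pd_const_mul (diffAt hW hy (contDiffOn_pd hW hF j))]
    ring
  have hmin : IsLocalMin (fun t : ℝ => F (y + t • w)) 0 := by
    have : Filter.Tendsto (fun t : ℝ => y + t • w) (𝓝 0) (𝓝 y) := by
      simpa [h0] using hcont.tendsto 0
    have := this.eventually h
    filter_upwards [this] with t ht
    simpa using ht
  -- A negative second derivative would make the same point a local maximum along the line, so the
  -- function would be locally constant there and its second derivative zero.
  have hmax : IsLocalMax (fun t : ℝ => F (y + t • w)) 0 := by
    refine isLocalMax_of_deriv_deriv_neg (by rw [hd2]; exact hneg) hmin.deriv_eq_zero ?_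
    refine ContinuousAt.comp (f := fun t : ℝ => y + t • w) ?_ hcont.continuousAt
    rw [h0]; exact (diffAt hW hy hF).continuousAt
  have hconst : (fun t : ℝ => F (y + t • w)) =ᶠ[𝓝 0] fun _ => F (y + (0 : ℝ) • w) := by
    filter_upwards [hmin, hmax] with t h1 h2
    exact le_antisymm h2 h1
  have : deriv (deriv (fun t : ℝ => F (y + t • w))) 0 = 0 := by
    rw [hconst.deriv.deriv_eq]; simp
  linarith [hd2 ▸ this, hneg]

-- Writing A = CᵀC turns the contraction into a sum of values of the quadratic form B on the rows of
-- C.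
open scoped MatrixOrder in
theorem sum_mul_nonneg_of_posSemidef {A : Matrix (Fin m) (Fin m) ℝ} (hA : A.PosSemidef)
    {B : Fin m → Fin m → ℝ} (hB : ∀ v : Fin m → ℝ, 0 ≤ ∑ i, ∑ j, v i * v j * B i j) :
    0 ≤ ∑ i, ∑ j, A i j * B i j := by
  obtain ⟨C, rfl⟩ := CStarAlgebra.nonneg_iff_eq_star_mul_self.mp hA.nonneg
  have : ∑ i, ∑ j, (star C * C) i j * B i j
      = ∑ k, ∑ i, ∑ j, C k i * C k j * B i j := by
    simp only [Matrix.mul_apply, Matrix.star_apply, star_trivial, Finset.sum_mul]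
    rw [Finset.sum_comm]
    conv_rhs => rw [Finset.sum_comm]
    conv_lhs => rw [Finset.sum_comm]
    exact Finset.sum_congr rfl fun i _ => Finset.sum_comm
  rw [this]
  exact Finset.sum_nonneg fun k _ => hB (C k)

/-- The second order operator `Aⁱʲ ∂ᵢ∂ⱼ + bᵏ ∂ₖ`. -/
def secondOrder (A : EuclideanSpace ℝ (Fin m) → Matrix (Fin m) (Fin m) ℝ)
    (b : Fin m → EuclideanSpace ℝ (Fin m) → ℝ) (F : EuclideanSpace ℝ (Fin m) → ℝ)
    (y : EuclideanSpace ℝ (Fin m)) : ℝ :=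
  ∑ i, ∑ j, A y i j * pd i (pd j F) y + ∑ k, b k y * pd k F y

variable {A : EuclideanSpace ℝ (Fin m) → Matrix (Fin m) (Fin m) ℝ}
  {b : Fin m → EuclideanSpace ℝ (Fin m) → ℝ}

theorem secondOrder_nonneg_of_isLocalMin (hW : IsOpen W) (hy : y ∈ W) (hF : ContDiffOn ℝ ∞ F W)
    (hA : (A y).PosSemidef) (h : IsLocalMin F y) : 0 ≤ secondOrder A b F y := by
  simp only [secondOrder, pd_eq_zero_of_isLocalMin h, mul_zero, Finset.sum_const_zero, add_zero]
  exact sum_mul_nonneg_of_posSemidef hA (hessian_nonneg_of_isLocalMin hW hy hF h)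

theorem secondOrder_sub_mul (hW : IsOpen W) (hy : y ∈ W) (hF : ContDiffOn ℝ ∞ F W)
    (hK : ContDiffOn ℝ ∞ K W) (c : ℝ) : secondOrder A b (fun z => F z - c * K z) y
      = secondOrder A b F y - c * secondOrder A b K y := by
  have hcK : ContDiffOn ℝ ∞ (fun z => c * K z) W := contDiffOn_const.mul hK
  simp only [secondOrder, pd_pd_sub hW hy hF hcK, pd_pd_const_mul hW hy hK,
    pd_sub (diffAt hW hy hF) (diffAt hW hy hcK), pd_const_mul (diffAt hW hy hK), mul_sub,
    Finset.sum_sub_distrib, mul_add, Finset.mul_sum]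
  have e1 : ∑ i, ∑ j, A y i j * (c * pd i (pd j K) y) = ∑ i, ∑ j, c * (A y i j * pd i (pd j K) y) :=
    Finset.sum_congr rfl fun i _ => Finset.sum_congr rfl fun j _ => by ring
  have e2 : ∑ k, b k y * (c * pd k K y) = ∑ k, c * (b k y * pd k K y) :=
    Finset.sum_congr rfl fun i _ => by ring
  rw [e1, e2]; ring

/-! ### Hopf's barrier and the strong minimum principle. -/

/-- Hopf's barrier. -/
def barrier (a R : ℝ) (c y : EuclideanSpace ℝ (Fin m)) : ℝ :=
  Real.exp (-a * ∑ k, (y k - c k) ^ 2) - R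

theorem contDiff_coord_apply (k : Fin m) :
    ContDiff ℝ ∞ fun z : EuclideanSpace ℝ (Fin m) => z k :=
  (EuclideanSpace.proj k : EuclideanSpace ℝ (Fin m) →L[ℝ] ℝ).contDiff

theorem pd_coord (i k : Fin m) : pd i (fun z => z k) y = if i = k then 1 else 0 := by
  have : HasFDerivAt (fun z : EuclideanSpace ℝ (Fin m) => z k)
    (EuclideanSpace.proj k : EuclideanSpace ℝ (Fin m) →L[ℝ] ℝ) y :=
    (EuclideanSpace.proj k : EuclideanSpace ℝ (Fin m) →L[ℝ] ℝ).hasFDerivAt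
  simp [pd, this.fderiv, eq_comm (a := i)]

theorem contDiff_barrier (a R : ℝ) (c : EuclideanSpace ℝ (Fin m)) :
    ContDiff ℝ ∞ (barrier a R c) := by
  unfold barrier
  refine ContDiff.sub (ContDiff.exp (contDiff_const.mul (ContDiff.sum fun k _ => ?_)))
    contDiff_const
  exact ((contDiff_coord_apply k).sub contDiff_const).pow 2

theorem pd_barrier (a R : ℝ) (c y : EuclideanSpace ℝ (Fin m)) (i : Fin m) :
    pd i (barrier a R c) y = -2 * a * ((y i - c i) * (barrier a 0 c y)) := by
  have hk : ∀ k, ContDiff ℝ ∞ fun z : EuclideanSpace ℝ (Fin m) => (z k - c k) ^ 2 :=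
    fun k => ((contDiff_coord_apply k).sub contDiff_const).pow 2
  have hq : ContDiff ℝ ∞ fun z : EuclideanSpace ℝ (Fin m) => ∑ k, (z k - c k) ^ 2 :=
    ContDiff.sum fun k _ => hk k
  have hd : ∀ {K : EuclideanSpace ℝ (Fin m) → ℝ}, ContDiff ℝ ∞ K → DifferentiableAt ℝ K y :=
    fun h => (h.differentiable (by simp)) y
  have h1 : ∀ k, pd i (fun z => (z k - c k) ^ 2) y = if i = k then 2 * (y k - c k) else 0 := by
    intro k
    simp only [pow_two]
    have hs := (contDiff_coord_apply k).sub (contDiff_const (c := c k))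
    rw [pd_mul (hd hs) (hd hs), pd_sub (hd (contDiff_coord_apply k)) (hd contDiff_const),
      pd_coord, pd_const]
    split_ifs <;> ring
  have h2 : pd i (fun z => -a * ∑ k, (z k - c k) ^ 2) y = -a * (2 * (y i - c i)) := by
    rw [pd_const_mul (hd hq), pd_sum _ (fun k _ => hd (hk k))]
    simp [h1]
  have h3 : pd i (barrier a R c) y = barrier a 0 c y
      * pd i (fun z => -a * ∑ k, (z k - c k) ^ 2) y := by
    have hq' : DifferentiableAt ℝ (fun z : EuclideanSpace ℝ (Fin m) =>
      -a * ∑ k, (z k - c k) ^ 2) y := hd (contDiff_const.mul hq)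
    unfold barrier
    simp only [pd, sub_zero]
    rw [fderiv_sub_const, fderiv_exp hq']
    rfl
  rw [h3, h2]; ring

theorem pd_pd_barrier (a R : ℝ) (c y : EuclideanSpace ℝ (Fin m)) (i j : Fin m) :
    pd i (pd j (barrier a R c)) y = barrier a 0 c y *
      (4 * a ^ 2 * ((y i - c i) * (y j - c j)) - 2 * a * (if i = j then 1 else 0)) := by
  have : pd j (barrier a R c) = fun y => -2 * a * ((y j - c j) * (barrier a 0 c y)) := by
    ext y; exact pd_barrier a R c y j
  have hd : ∀ {K : EuclideanSpace ℝ (Fin m) → ℝ}, ContDiff ℝ ∞ K → DifferentiableAt ℝ K y :=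
    fun h => (h.differentiable (by simp)) y
  have hs := (contDiff_coord_apply j).sub (contDiff_const (c := c j))
  have hb := contDiff_barrier a 0 c
  rw [this, pd_const_mul (hd (hs.mul hb)), pd_mul (hd hs) (hd hb),
    pd_sub (hd (contDiff_coord_apply j)) (hd contDiff_const), pd_coord, pd_const, pd_barrier]
  ring

theorem secondOrder_barrier (a R : ℝ) (c y : EuclideanSpace ℝ (Fin m)) :
    secondOrder A b (barrier a R c) y = barrier a 0 c y * (2 * a) *
      (2 * a * ∑ i, ∑ j, A y i j * ((y i - c i) * (y j - c j))
        - (∑ i, A y i i + ∑ k, b k y * (y k - c k))) := by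
  simp only [secondOrder, pd_pd_barrier, pd_barrier]
  have e1 : ∀ i, ∑ j, A y i j * (barrier a 0 c y *
      (4 * a ^ 2 * ((y i - c i) * (y j - c j)) - 2 * a * (if i = j then 1 else 0)))
      = (barrier a 0 c y * (4 * a ^ 2)) * ∑ j, A y i j * ((y i - c i) * (y j - c j))
        - (barrier a 0 c y * (2 * a)) * A y i i := by
    intro i
    have : ∀ j, A y i j * (barrier a 0 c y *
      (4 * a ^ 2 * ((y i - c i) * (y j - c j)) - 2 * a * (if i = j then 1 else 0)))
      = (barrier a 0 c y * (4 * a ^ 2)) * (A y i j * ((y i - c i) * (y j - c j)))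
        - if i = j then barrier a 0 c y * (2 * a) * A y i j else 0 := by
      intro j; split_ifs <;> ring
    simp only [this, Finset.sum_sub_distrib, ← Finset.mul_sum]
    simp
  have e2 : ∑ k, b k y * (-2 * a * ((y k - c k) * barrier a 0 c y))
      = -(barrier a 0 c y * (2 * a)) * ∑ k, b k y * (y k - c k) := by
    rw [Finset.mul_sum]
    exact Finset.sum_congr rfl fun k _ => by ring
  simp only [e1, e2, Finset.sum_sub_distrib, ← Finset.mul_sum]
  ring

theorem sum_sub_sq_eq (c y : EuclideanSpace ℝ (Fin m)) :
    ∑ k, (y k - c k) ^ 2 = dist y c ^ 2 := by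
  rw [EuclideanSpace.dist_eq, Real.sq_sqrt (Finset.sum_nonneg fun _ _ => sq_nonneg _)]
  exact Finset.sum_congr rfl fun k _ => by rw [Real.dist_eq, sq_abs]

/-- A supersolution that exceeds its lower bound `t` in a punctured closed ball touching a point
where the value is `t` does not exist. -/
theorem not_touching (hW : IsOpen W) (hy : y ∈ W) (hF : ContDiffOn ℝ ∞ F W)
    (hA : ∀ z ∈ W, (A z).PosDef) (hAc : ∀ i j, ContinuousOn (fun z => A z i j) W)
    (hbc : ∀ k, ContinuousOn (b k) W) (hL : ∀ z ∈ W, secondOrder A b F z ≤ 0)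
    {t : ℝ} (hF0 : ∀ z ∈ W, t ≤ F z) (hFy : F y = t) {c : EuclideanSpace ℝ (Fin m)} (hc : c ≠ y)
    (hball : ∀ z ∈ W, dist z c ≤ dist y c → z ≠ y → t < F z) : False := by
  let q : EuclideanSpace ℝ (Fin m) → ℝ := fun z => ∑ i, ∑ j, A z i j * ((z i - c i) * (z j - c j))
  let r : EuclideanSpace ℝ (Fin m) → ℝ := fun z => ∑ i, A z i i + ∑ k, b k z * (z k - c k)
  have hq : 0 < q y := by
    have hv : (fun i => y i - c i) ≠ 0 := by
      intro h0; apply hc; ext i; have := congrFun h0 i; simp at this; linarith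
    have := (hA y hy).dotProduct_mulVec_pos hv
    simp only [dotProduct, Matrix.mulVec, star_trivial, Pi.star_apply, Finset.mul_sum] at this
    refine this.trans_eq (Finset.sum_congr rfl fun i _ => Finset.sum_congr rfl fun j _ => by ring)
  have hcc : ∀ k, ContinuousOn (fun z : EuclideanSpace ℝ (Fin m) => z k - c k) W := fun k =>
    ((contDiff_coord_apply k).continuous.sub continuous_const).continuousOn
  have hqc : ContinuousOn q W := continuousOn_finsetSum _ fun i _ =>
    continuousOn_finsetSum _ fun j _ => (hAc i j).mul ((hcc i).mul (hcc j))
  have hrc : ContinuousOn r W := (continuousOn_finsetSum _ fun i _ => hAc i i).add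
    (continuousOn_finsetSum _ fun k _ => (hbc k).mul (hcc k))
  -- By `secondOrder_barrier`, the sign of the operator on the barrier is that of 2aq - r. As q(y) >
  -- 0 by ellipticity, a large a makes it positive at y, and continuity keeps it so nearby.
  obtain ⟨a, ha0, ha⟩ : ∃ a : ℝ, 0 < a ∧ 0 < 2 * a * q y - r y := by
    refine ⟨(|r y| + 1) / q y, by positivity, ?_⟩
    have : 2 * ((|r y| + 1) / q y) * q y = 2 * (|r y| + 1) := by field_simp
    rw [this]
    linarith [le_abs_self (r y), abs_nonneg (r y)]
  have hcont : ContinuousAt (fun z => 2 * a * q z - r z) y :=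
    ((continuousOn_const.mul hqc).sub hrc).continuousAt (hW.mem_nhds hy)
  obtain ⟨s, hs0, hs⟩ : ∃ s > 0, Metric.closedBall y s ⊆ {z | z ∈ W ∧ 0 < 2 * a * q z - r z} :=
    Metric.nhds_basis_closedBall.mem_iff.mp
      (Filter.inter_mem (hW.mem_nhds hy) (hcont.eventually_const_lt ha))
  let w := barrier a (Real.exp (-a * dist y c ^ 2)) c
  have hw : ∀ z, w z = Real.exp (-a * dist z c ^ 2) - Real.exp (-a * dist y c ^ 2) := by
    intro z; simp only [w, barrier, sum_sub_sq_eq]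
  have hLw : ∀ z ∈ Metric.closedBall y s, 0 < secondOrder A b w z := by
    intro z hz
    rw [secondOrder_barrier]
    have : 0 < barrier a 0 c z := by simp only [barrier, sub_zero]; positivity
    exact mul_pos (by positivity) (hs hz).2
  have hcpt : IsCompact (Metric.sphere y s ∩ Metric.closedBall c (dist y c)) :=
    (isCompact_sphere y s).inter_right Metric.isClosed_closedBall
  have hsub : Metric.sphere y s ⊆ W := fun z hz => (hs (Metric.sphere_subset_closedBall hz)).1
  -- On the part of the small sphere inside the touching ball, F exceeds t by a uniform gap, by
  -- compactness.
  obtain ⟨μ, hμ, hμF⟩ := hcpt.exists_forall_le' (f := F) (a := t)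
    (hF.continuousOn.mono fun z hz => hsub hz.1) fun z hz =>
      hball z (hsub hz.1) hz.2 (by
      rintro rfl
      have h0 : dist z z = s := hz.1
      rw [dist_self] at h0; linarith)
  -- Since w ≤ 1, subtracting half the gap times w keeps ψ above t on that part of the sphere; on
  -- the rest w < 0 only raises ψ.
  let ε := (μ - t) / 2
  have hε : 0 < ε := by simp only [ε]; linarith
  let ψ : EuclideanSpace ℝ (Fin m) → ℝ := fun z => F z - ε * w z
  have hψs : ContDiffOn ℝ ∞ ψ W :=
    hF.sub (contDiffOn_const.mul (contDiff_barrier _ _ _).contDiffOn)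
  obtain ⟨z, hz, hzmin⟩ := (isCompact_closedBall y s).exists_isMinOn
    ⟨y, Metric.mem_closedBall_self hs0.le⟩ (hψs.continuousOn.mono fun z hz => (hs hz).1)
  have hψy : ψ y = t := by simp [ψ, hw, hFy]
  have hzy : ψ z ≤ t := hψy ▸ hzmin (Metric.mem_closedBall_self hs0.le)
  -- As ψ > t on the sphere while ψ y = t, the minimum is interior. There the operator on ψ would
  -- have to be nonnegative, although it is negative throughout.
  have hzb : z ∈ Metric.ball y s := by
    rw [Metric.mem_ball]
    refine lt_of_le_of_ne (Metric.mem_closedBall.mp hz) fun hzs => ?_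
    by_cases hzc : dist z c ≤ dist y c
    · have h1 := hμF z ⟨hzs, hzc⟩
      have h2 : w z ≤ 1 := by
        rw [hw]
        have : Real.exp (-a * dist z c ^ 2) ≤ 1 := by
          rw [Real.exp_le_one_iff]; nlinarith [sq_nonneg (dist z c)]
        linarith [Real.exp_pos (-a * dist y c ^ 2)]
      have h3 : ε * w z ≤ ε := by nlinarith
      simp only [ψ, ε] at hzy h3
      linarith
    · push Not at hzc
      have h1 : w z < 0 := by
        rw [hw, sub_neg, Real.exp_lt_exp]
        have : dist y c ^ 2 < dist z c ^ 2 := by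
          apply pow_lt_pow_left₀ hzc dist_nonneg; norm_num
        nlinarith
      have h2 := hF0 z (hs hz).1
      have h3 : ε * w z < 0 := mul_neg_of_pos_of_neg hε h1
      simp only [ψ] at hzy
      linarith
  have hloc : IsLocalMin ψ z := (hzmin.on_subset Metric.ball_subset_closedBall).isLocalMin
    (Metric.isOpen_ball.mem_nhds hzb)
  have hzW := (hs hz).1
  have h1 := secondOrder_nonneg_of_isLocalMin (b := b) hW hzW hψs (hA z hzW).posSemidef hloc
  rw [secondOrder_sub_mul hW hzW hF (contDiff_barrier _ _ _).contDiffOn] at h1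
  have := mul_pos hε (hLw z hz)
  linarith [hL z hzW]

/-- Hopf's strong minimum principle: the set where a supersolution attains its minimum is open. -/
theorem eventually_eq_of_secondOrder_nonpos (hW : IsOpen W) (hy : y ∈ W) (hF : ContDiffOn ℝ ∞ F W)
    (hA : ∀ z ∈ W, (A z).PosDef) (hAc : ∀ i j, ContinuousOn (fun z => A z i j) W)
    (hbc : ∀ k, ContinuousOn (b k) W) (hL : ∀ z ∈ W, secondOrder A b F z ≤ 0)
    (hmin : ∀ z ∈ W, F y ≤ F z) : ∀ᶠ z in 𝓝 y, F z = F y := by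
  obtain ⟨s, hs0, hs⟩ := Metric.nhds_basis_closedBall.mem_iff.mp (hW.mem_nhds hy)
  filter_upwards [Metric.ball_mem_nhds y (half_pos hs0)] with x hx
  by_contra hne
  have hxy : dist x y < s / 2 := hx
  -- the point nearest to `x` in the contact set
  have hcpt : IsCompact (Metric.closedBall y s ∩ F ⁻¹' {F y}) :=
    (isCompact_closedBall y s).of_isClosed_subset
      ((hF.continuousOn.mono hs).preimage_isClosed_of_isClosed Metric.isClosed_closedBall
        isClosed_singleton) Set.inter_subset_left
  obtain ⟨p, hp, hpmin⟩ := hcpt.exists_isMinOn (f := fun z => dist z x)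
    ⟨y, Metric.mem_closedBall_self hs0.le, rfl⟩ (by fun_prop)
  have hpx : dist p x < s / 2 := by
    have : dist p x ≤ dist y x := hpmin ⟨Metric.mem_closedBall_self hs0.le, rfl⟩
    rw [dist_comm y x] at this; linarith
  have hne' : p ≠ x := by rintro rfl; exact hne hp.2
  have hFp : F p = F y := hp.2
  -- The open ball about x through p misses the contact set inside the larger ball, but its boundary
  -- may touch it elsewhere. The ball of half the radius centred at the midpoint touches it at p
  -- alone.
  let c := midpoint ℝ x p
  have hcp : dist p c = dist p x / 2 := by
    rw [dist_right_midpoint, dist_comm]; simp; ring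
  have hcx : dist c x = dist p x / 2 := by
    rw [dist_midpoint_left, dist_comm]; simp; ring
  refine not_touching hW (hs hp.1) hF hA hAc hbc hL (t := F p) (fun z hz => hFp ▸ hmin z hz) rfl
    (c := c) (fun h => ?_) fun z hz hzc hzp => ?_
  · have h0 := hcp
    rw [h, dist_self] at h0
    exact hne' (dist_eq_zero.mp (by linarith))
  · refine lt_of_le_of_ne (hFp ▸ hmin z hz) fun hFz => hzp ?_
    have hzx : dist z x ≤ dist p x := by
      have := dist_triangle z c x; linarith
    have hzs : z ∈ Metric.closedBall y s := by
      have := dist_triangle z x y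
      rw [Metric.mem_closedBall]; linarith
    have hge : dist p x ≤ dist z x := hpmin ⟨hzs, hFz.symm.trans hFp⟩
    have hzx' : dist z x = dist p x := le_antisymm hzx hge
    -- Equality in the triangle inequality forces c to be the midpoint of z and x as well, so z = p.
    have hzc' : dist z c = dist p x / 2 := by
      have := dist_triangle z c x; linarith
    have h1 : c = midpoint ℝ z x :=
      eq_midpoint_of_dist_eq_half (by rw [hzc', hzx']) (by rw [hcx, hzx'])
    have h2 : midpoint ℝ z x = midpoint ℝ p x := by rw [← h1, midpoint_comm]
    have h3 := (midpoint_eq_midpoint_iff_vsub_eq_vsub ℝ).mp h2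
    simpa [sub_eq_zero] using h3

end MaximumPrinciple

/-! Metrics in charts. -/

section Charts

open IsManifold

variable {m n : ℕ}
  {M : Type*} [TopologicalSpace M] [ChartedSpace (EuclideanSpace ℝ (Fin m)) M]
  [IsManifold (𝓡 m) ∞ M]
  {N : Type*} [TopologicalSpace N] [ChartedSpace (EuclideanSpace ℝ (Fin n)) N]
  [IsManifold (𝓡 n) ∞ N]
  {e e' : OpenPartialHomeomorph M (EuclideanSpace ℝ (Fin m))}
  {d : OpenPartialHomeomorph N (EuclideanSpace ℝ (Fin n))}
  {y : EuclideanSpace ℝ (Fin m)}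

theorem mdifferentiableAt_chart_symm (he : e ∈ maximalAtlas (𝓡 m) ∞ M) (hy : y ∈ e.target) :
    MDifferentiableAt (𝓡 m) (𝓡 m) e.symm y :=
  (contMDiffAt_symm_of_mem_maximalAtlas he hy).mdifferentiableAt (by simp)

theorem mfderiv_chart_symm_injective (he : e ∈ maximalAtlas (𝓡 m) ∞ M) (hy : y ∈ e.target) :
    Function.Injective (mfderiv (𝓡 m) (𝓡 m) e.symm y) := by
  have h : e.MDifferentiable (𝓡 m) (𝓡 m) :=
    ⟨(contMDiffOn_of_mem_maximalAtlas he).mdifferentiableOn (by simp),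
      (contMDiffOn_symm_of_mem_maximalAtlas he).mdifferentiableOn (by simp)⟩
  exact h.symm.mfderiv_injective hy

theorem metric_congr (h : Metric n N) {x x' : N} (hx : x = x') (v w : EuclideanSpace ℝ (Fin n)) :
    h.inner x v w = h.inner x' v w := by subst hx; rfl

theorem contMDiffOn_coordVec (he : e ∈ maximalAtlas (𝓡 m) ∞ M) (i : Fin m) :
    ContMDiffOn (𝓡 m) ((𝓡 m).prod 𝓘(ℝ, EuclideanSpace ℝ (Fin m))) ∞
      (fun z => (Bundle.TotalSpace.mk' (EuclideanSpace ℝ (Fin m)) (e.symm z) (coordVec e i z) :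
        TangentBundle (𝓡 m) M)) e.target := by
  have h1 := (contMDiffOn_symm_of_mem_maximalAtlas he).contMDiffOn_tangentMapWithin
    (m := ∞) (by simp) e.open_target.uniqueMDiffOn
  have h2 : ContMDiff (𝓡 m) ((𝓡 m).prod 𝓘(ℝ, EuclideanSpace ℝ (Fin m))) ∞
      (fun z : EuclideanSpace ℝ (Fin m) => (Bundle.TotalSpace.mk' (EuclideanSpace ℝ (Fin m)) z
        (EuclideanSpace.single i (1 : ℝ) : EuclideanSpace ℝ (Fin m)) :
        TangentBundle (𝓡 m) (EuclideanSpace ℝ (Fin m)))) := by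
    intro x
    rw [Bundle.contMDiffAt_totalSpace]
    refine ⟨contMDiffAt_id, ?_⟩
    simp
    exact contMDiffAt_const
  refine (h1.comp h2.contMDiffOn (s := e.target) fun z hz => hz).congr fun z hz => ?_
  simp only [Function.comp, tangentMapWithin, coordVec]
  rw [mfderivWithin_of_isOpen e.open_target hz]

theorem contDiffOn_metricCoeff (g : Metric m M) (he : e ∈ maximalAtlas (𝓡 m) ∞ M) (i j : Fin m) :
    ContDiffOn ℝ ∞ (fun z => metricCoeff g e z i j) e.target := by
  rw [← contMDiffOn_iff_contDiffOn]
  have hg := g.contMDiff.comp_contMDiffOn (contMDiffOn_symm_of_mem_maximalAtlas he)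
  have := ContMDiffOn.clm_bundle_apply₂ (F₁ := EuclideanSpace ℝ (Fin m))
    (F₂ := EuclideanSpace ℝ (Fin m)) (F₃ := ℝ) (E₃ := fun _ : M => ℝ)
    hg (contMDiffOn_coordVec he i) (contMDiffOn_coordVec he j)
  intro z hz
  have h2 := this z hz
  rw [Bundle.contMDiffWithinAt_totalSpace] at h2
  exact h2.2

theorem metricCoeff_symm (g : Metric m M) (z : EuclideanSpace ℝ (Fin m)) (i j : Fin m) :
    metricCoeff g e z i j = metricCoeff g e z j i := g.symm _ _ _

theorem posDef_metricCoeff (g : Metric m M) (he : e ∈ maximalAtlas (𝓡 m) ∞ M)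
    (hy : y ∈ e.target) : (metricCoeff g e y).PosDef := by
  refine Matrix.PosDef.of_dotProduct_mulVec_pos ?_ fun v hv => ?_
  · ext i j
    simp only [Matrix.conjTranspose_apply, star_trivial]
    exact metricCoeff_symm g y j i
  · let w : EuclideanSpace ℝ (Fin m) := WithLp.toLp 2 v
    have hw : w = ∑ i, v i • EuclideanSpace.single i (1 : ℝ) := by
      ext j; simp [w, Pi.single_apply]
    have hw0 : mfderiv (𝓡 m) (𝓡 m) e.symm y w ≠ 0 := by
      intro h0
      have : w = 0 := mfderiv_chart_symm_injective he hy (h0.trans (map_zero _).symm)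
      apply hv; ext i; exact congrArg (fun z : EuclideanSpace ℝ (Fin m) => z i) this
    have hexp : mfderiv (𝓡 m) (𝓡 m) e.symm y w = ∑ i, v i • coordVec e i y := by
      rw [hw]
      exact (map_sum _ _ _).trans (Finset.sum_congr rfl fun i _ => map_smul _ _ _)
    have := g.pos _ _ hw0
    rw [hexp] at this
    simp only [map_sum, map_smul, sum_apply, smul_apply,
      smul_eq_mul] at this
    simp only [dotProduct, Matrix.mulVec, star_trivial, Finset.mul_sum, Pi.star_apply]
    rw [Finset.sum_comm]
    refine this.trans_eq (Finset.sum_congr rfl fun i _ => ?_)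
    rw [Finset.mul_sum]
    exact Finset.sum_congr rfl fun j _ => by
      simp only [metricCoeff, Matrix.of_apply]; ring

theorem smoothMetricOn_metricCoeff (g : Metric m M) (he : e ∈ maximalAtlas (𝓡 m) ∞ M) :
    SmoothMetricOn (metricCoeff g e) e.target where
  isOpen := e.open_target
  smooth := contDiffOn_metricCoeff g he
  symm _ _ i j := metricCoeff_symm g _ i j
  det_ne _ hz := (posDef_metricCoeff g he hz).det_pos.ne'

theorem fderiv_single_eq_sum {U : EuclideanSpace ℝ (Fin m) → EuclideanSpace ℝ (Fin n)}
    (hU : DifferentiableAt ℝ U y) (i : Fin m) :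
    fderiv ℝ U y (EuclideanSpace.single i 1)
      = ∑ a, pd i (fun z => U z a) y • EuclideanSpace.single a (1 : ℝ) := by
  ext b
  have h := ((EuclideanSpace.proj b : EuclideanSpace ℝ (Fin n) →L[ℝ] ℝ).hasFDerivAt.comp y
      hU.hasFDerivAt).fderiv
  have h' : pd i (fun z => U z b) y = fderiv ℝ U y (EuclideanSpace.single i 1) b := by
    change fderiv ℝ ((EuclideanSpace.proj b : EuclideanSpace ℝ (Fin n) →L[ℝ] ℝ) ∘ U) y _ = _
    rw [h]; rfl
  simp [Pi.single_apply, h']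

/-- The expression of `u` in charts is smooth where it is defined. -/
theorem contDiffOn_chart_expression {u : M → N} (hu : ContMDiff (𝓡 m) (𝓡 n) ∞ u)
    (he : e ∈ maximalAtlas (𝓡 m) ∞ M) (hd : d ∈ maximalAtlas (𝓡 n) ∞ N) :
    ContDiffOn ℝ ∞ (d ∘ u ∘ e.symm) (e.target ∩ e.symm ⁻¹' (u ⁻¹' d.source)) := by
  rw [← contMDiffOn_iff_contDiffOn]
  exact (contMDiffOn_of_mem_maximalAtlas hd).comp
    (hu.comp_contMDiffOn ((contMDiffOn_symm_of_mem_maximalAtlas he).mono Set.inter_subset_left))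
    fun z hz => hz.2

theorem isOpen_chart_expression {u : M → N} (hu : ContMDiff (𝓡 m) (𝓡 n) ∞ u) :
    IsOpen (e.target ∩ e.symm ⁻¹' (u ⁻¹' d.source)) :=
  e.isOpen_inter_preimage_symm (d.open_source.preimage hu.continuous)

/-- Chain rule applied to u ∘ e⁻¹ = d⁻¹ ∘ (d ∘ u ∘ e⁻¹), valid near y. -/
theorem mfderiv_coordVec {u : M → N} (hu : ContMDiff (𝓡 m) (𝓡 n) ∞ u)
    (he : e ∈ maximalAtlas (𝓡 m) ∞ M) (hd : d ∈ maximalAtlas (𝓡 n) ∞ N)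
    (hy : y ∈ e.target ∩ e.symm ⁻¹' (u ⁻¹' d.source)) (i : Fin m) :
    (mfderiv (𝓡 m) (𝓡 n) u (e.symm y) (coordVec e i y) : EuclideanSpace ℝ (Fin n))
      = ∑ a, pd i (fun z => (d ∘ u ∘ e.symm) z a) y •
        (coordVec d a ((d ∘ u ∘ e.symm) y) : EuclideanSpace ℝ (Fin n)) := by
  have hO := isOpen_chart_expression (e := e) (d := d) hu
  have hU : DifferentiableAt ℝ (d ∘ u ∘ e.symm) y :=
    ((contDiffOn_chart_expression hu he hd).contDiffAt (hO.mem_nhds hy)).differentiableAt (by simp)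
  have hev : u ∘ e.symm =ᶠ[𝓝 y] d.symm ∘ (d ∘ u ∘ e.symm) := by
    filter_upwards [hO.mem_nhds hy] with z hz
    exact (d.left_inv hz.2).symm
  have hdt : (d ∘ u ∘ e.symm) y ∈ d.target := d.map_source hy.2
  have h1 : mfderiv (𝓡 m) (𝓡 n) (u ∘ e.symm) y
      = (mfderiv (𝓡 m) (𝓡 n) u (e.symm y)).comp (mfderiv (𝓡 m) (𝓡 m) e.symm y) :=
    mfderiv_comp y (hu.mdifferentiableAt (by simp)) (mdifferentiableAt_chart_symm he hy.1)
  have h2 : mfderiv (𝓡 m) (𝓡 n) (d.symm ∘ (d ∘ u ∘ e.symm)) y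
      = (mfderiv (𝓡 n) (𝓡 n) d.symm ((d ∘ u ∘ e.symm) y)).comp
        (mfderiv (𝓡 m) (𝓡 n) (d ∘ u ∘ e.symm) y) :=
    mfderiv_comp y (mdifferentiableAt_chart_symm hd hdt) hU.mdifferentiableAt
  have h3 : (mfderiv (𝓡 m) (𝓡 n) u (e.symm y) (coordVec e i y) : EuclideanSpace ℝ (Fin n))
      = mfderiv (𝓡 m) (𝓡 n) (u ∘ e.symm) y (EuclideanSpace.single i (1 : ℝ)) := by
    rw [h1]; rfl
  rw [h3]
  have h4 : (mfderiv (𝓡 m) (𝓡 n) (u ∘ e.symm) y :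
      EuclideanSpace ℝ (Fin m) →L[ℝ] EuclideanSpace ℝ (Fin n))
      = mfderiv (𝓡 m) (𝓡 n) (d.symm ∘ (d ∘ u ∘ e.symm)) y := hev.mfderiv_eq
  have h5 : (mfderiv (𝓡 m) (𝓡 n) (u ∘ e.symm) y (EuclideanSpace.single i (1 : ℝ)) :
      EuclideanSpace ℝ (Fin n)) = mfderiv (𝓡 n) (𝓡 n) d.symm ((d ∘ u ∘ e.symm) y)
        (fderiv ℝ (d ∘ u ∘ e.symm) y (EuclideanSpace.single i (1 : ℝ))) := by
    refine (congrArg (fun L : EuclideanSpace ℝ (Fin m) →L[ℝ] EuclideanSpace ℝ (Fin n) =>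
      L (EuclideanSpace.single i (1 : ℝ))) (h4.trans h2)).trans ?_
    rw [mfderiv_eq_fderiv]; rfl
  rw [h5, fderiv_single_eq_sum hU]
  exact (map_sum _ _ _).trans (Finset.sum_congr rfl fun a _ => map_smul _ _ _)

theorem pullbackCoeff_eq (h : Metric n N) {u : M → N} (hu : ContMDiff (𝓡 m) (𝓡 n) ∞ u)
    (he : e ∈ maximalAtlas (𝓡 m) ∞ M) (hd : d ∈ maximalAtlas (𝓡 n) ∞ N)
    (hy : y ∈ e.target ∩ e.symm ⁻¹' (u ⁻¹' d.source)) (i j : Fin m) :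
    pullbackCoeff h u e i j y = pullbackMatrix (metricCoeff h d) (d ∘ u ∘ e.symm) i j y := by
  have hpt : u (e.symm y) = d.symm ((d ∘ u ∘ e.symm) y) := (d.left_inv hy.2).symm
  have h1 : pullbackCoeff h u e i j y = h.inner (d.symm ((d ∘ u ∘ e.symm) y))
      (∑ a, pd i (fun z => (d ∘ u ∘ e.symm) z a) y •
        (coordVec d a ((d ∘ u ∘ e.symm) y)))
      (∑ a, pd j (fun z => (d ∘ u ∘ e.symm) z a) y •
        (coordVec d a ((d ∘ u ∘ e.symm) y))) := by
    unfold pullbackCoeff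
    refine (metric_congr h hpt _ _).trans ?_
    have e1 := mfderiv_coordVec hu he hd hy i
    have e2 := mfderiv_coordVec hu he hd hy j
    exact congrArg₂ (fun v w : EuclideanSpace ℝ (Fin n) =>
      h.inner (d.symm ((d ∘ u ∘ e.symm) y)) v w) e1 e2
  rw [h1]
  simp only [map_sum, map_smul, sum_apply, smul_apply,
      smul_eq_mul, pullbackMatrix, metricCoeff, Matrix.of_apply]
  conv_rhs => rw [Finset.sum_comm]
  refine Finset.sum_congr rfl fun a _ => ?_
  rw [Finset.mul_sum]
  exact Finset.sum_congr rfl fun b _ => by ring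

/-- This makes the transition between two charts of M the special case u = id of the pullback
formula. -/
theorem pullbackCoeff_id (g : Metric m M) (i j : Fin m) :
    pullbackCoeff g id e i j y = metricCoeff g e y i j := by
  simp only [pullbackCoeff, mfderiv_id, metricCoeff, Matrix.of_apply]
  rfl

theorem isChange_chart (g : Metric m M) (he : e ∈ maximalAtlas (𝓡 m) ∞ M)
    (he' : e' ∈ maximalAtlas (𝓡 m) ∞ M) :
    IsChange (metricCoeff g e) (metricCoeff g e') e.target
      (e'.target ∩ e'.symm ⁻¹' e.source) (e ∘ e'.symm) where
  left := smoothMetricOn_metricCoeff g he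
  right :=
    { isOpen := isOpen_chart_expression (u := id) contMDiff_id
      smooth := fun i j => (contDiffOn_metricCoeff g he' i j).mono Set.inter_subset_left
      symm := fun z _ i j => metricCoeff_symm g z i j
      det_ne := fun z hz => (posDef_metricCoeff g he' hz.1).det_pos.ne' }
  smooth := contDiffOn_chart_expression (u := id) contMDiff_id he' he
  mapsTo z hz := e.map_source hz.2
  eq z hz i j := by
    rw [← pullbackCoeff_id g]
    exact pullbackCoeff_eq g contMDiff_id he' he hz i j

theorem contDiffOn_comp_chart_symm {F : M → ℝ} (hF : ContMDiff (𝓡 m) 𝓘(ℝ, ℝ) ∞ F)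
    (he : e ∈ maximalAtlas (𝓡 m) ∞ M) : ContDiffOn ℝ ∞ (F ∘ e.symm) e.target := by
  rw [← contMDiffOn_iff_contDiffOn]
  exact hF.comp_contMDiffOn (contMDiffOn_symm_of_mem_maximalAtlas he)

/-- `|∇F|²`. -/
def gradSq (g : Metric m M) (F : M → ℝ) (x : M) : ℝ :=
  let e := chartAt (EuclideanSpace ℝ (Fin m)) x
  gradInner (metricCoeff g e) (F ∘ e.symm) (F ∘ e.symm) (e x)

theorem hess_congr {G : EuclideanSpace ℝ (Fin m) → Matrix (Fin m) (Fin m) ℝ}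
    {W : Set (EuclideanSpace ℝ (Fin m))} (hW : IsOpen W) (hy : y ∈ W)
    {F K : EuclideanSpace ℝ (Fin m) → ℝ} (h : ∀ z ∈ W, F z = K z) (i j : Fin m) :
    hess G F i j y = hess G K i j y := by
  simp only [hess, pd_congr hW hy h,
    pd_congr hW hy (fun z hz => pd_congr hW hz h j) i]

/-- `laplacian` uses a different preferred chart at each point; invariance under `IsChange` lets it
be read, and then differentiated, in one fixed chart. -/
theorem laplacian_eq (g : Metric m M) {F : M → ℝ} (hF : ContMDiff (𝓡 m) 𝓘(ℝ, ℝ) ∞ F)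
    (he : e ∈ maximalAtlas (𝓡 m) ∞ M) (hy : y ∈ e.target) :
    laplacian g F (e.symm y)
      = metricTrace (metricCoeff g e) (fun i j => hess (metricCoeff g e) (F ∘ e.symm) i j y) y := by
  set e₀ := chartAt (EuclideanSpace ℝ (Fin m)) (e.symm y) with he₀
  have hm₀ : e₀ ∈ maximalAtlas (𝓡 m) ∞ M := chart_mem_maximalAtlas _
  have hy0 : y ∈ e.target ∩ e.symm ⁻¹' e₀.source := ⟨hy, mem_chart_source _ _⟩
  have hch := isChange_chart g hm₀ he
  have h := hch.laplacian_eq hy0 (contDiffOn_comp_chart_symm hF hm₀)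
  have hc : ∀ z ∈ e.target ∩ e.symm ⁻¹' e₀.source,
      (F ∘ e₀.symm) ((e₀ ∘ e.symm) z) = (F ∘ e.symm) z := fun z hz => by
    simp only [Function.comp]; rw [e₀.left_inv hz.2]
  simp only [hess_congr hch.right.isOpen hy0 hc] at h
  exact h.symm

theorem gradSq_eq (g : Metric m M) {F : M → ℝ} (hF : ContMDiff (𝓡 m) 𝓘(ℝ, ℝ) ∞ F)
    (he : e ∈ maximalAtlas (𝓡 m) ∞ M) (hy : y ∈ e.target) :
    gradSq g F (e.symm y) = gradInner (metricCoeff g e) (F ∘ e.symm) (F ∘ e.symm) y := by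
  set e₀ := chartAt (EuclideanSpace ℝ (Fin m)) (e.symm y) with he₀
  have hm₀ : e₀ ∈ maximalAtlas (𝓡 m) ∞ M := chart_mem_maximalAtlas _
  have hy0 : y ∈ e.target ∩ e.symm ⁻¹' e₀.source := ⟨hy, mem_chart_source _ _⟩
  have hch := isChange_chart g hm₀ he
  have hs := contDiffOn_comp_chart_symm hF hm₀
  have h := hch.gradInner_eq hy0 hs hs
  have hc : ∀ z ∈ e.target ∩ e.symm ⁻¹' e₀.source,
      (F ∘ e₀.symm) ((e₀ ∘ e.symm) z) = (F ∘ e.symm) z := fun z hz => by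
    simp only [Function.comp]; rw [e₀.left_inv hz.2]
  simp only [gradInner, pd_congr hch.right.isOpen hy0 hc] at h
  exact h.symm

/-- A function whose expression in every chart of the maximal atlas is smooth is smooth. -/
theorem contMDiff_of_charts {F : M → ℝ}
    (h : ∀ e ∈ maximalAtlas (𝓡 m) ∞ M, ContDiffOn ℝ ∞ (F ∘ e.symm) e.target) :
    ContMDiff (𝓡 m) 𝓘(ℝ, ℝ) ∞ F := by
  intro x
  set e := chartAt (EuclideanSpace ℝ (Fin m)) x with hedef
  have he : e ∈ maximalAtlas (𝓡 m) ∞ M := chart_mem_maximalAtlas _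
  have hx : x ∈ e.source := mem_chart_source _ _
  have h1 : ContMDiffOn (𝓡 m) 𝓘(ℝ, ℝ) ∞ ((F ∘ e.symm) ∘ e) e.source :=
    (contMDiffOn_iff_contDiffOn.mpr (h e he)).comp (contMDiffOn_of_mem_maximalAtlas he)
      fun z hz => e.map_source hz
  have h2 := h1.congr (f₁ := F) fun z hz => by simp [e.left_inv hz]
  exact h2.contMDiffAt (e.open_source.mem_nhds hx)

theorem contMDiff_laplacian (g : Metric m M) {F : M → ℝ} (hF : ContMDiff (𝓡 m) 𝓘(ℝ, ℝ) ∞ F) :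
    ContMDiff (𝓡 m) 𝓘(ℝ, ℝ) ∞ (laplacian g F) :=
  contMDiff_of_charts fun e he => by
    have hG := smoothMetricOn_metricCoeff g he
    refine ContDiffOn.congr (contDiffOn_metricTrace hG.smooth hG.det_ne
      (contDiffOn_hess hG.isOpen hG.smooth hG.det_ne (contDiffOn_comp_chart_symm hF he)))
      fun z hz => laplacian_eq g hF he hz

theorem contMDiff_gradSq (g : Metric m M) {F : M → ℝ} (hF : ContMDiff (𝓡 m) 𝓘(ℝ, ℝ) ∞ F) :
    ContMDiff (𝓡 m) 𝓘(ℝ, ℝ) ∞ (gradSq g F) :=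
  contMDiff_of_charts fun e he => by
    have hG := smoothMetricOn_metricCoeff g he
    have hs := contDiffOn_comp_chart_symm hF he
    exact ContDiffOn.congr (contDiffOn_gradInner hG.isOpen hG.smooth hG.det_ne hs hs)
      fun z hz => gradSq_eq g hF he hz

end Charts

/-! Existence of normal coordinates. -/

section NormalCoordinates

open IsManifold

variable {m : ℕ}

theorem exists_openPartialHomeomorph
    {ψ : EuclideanSpace ℝ (Fin m) → EuclideanSpace ℝ (Fin m)} (hψ : ContDiff ℝ ∞ ψ)
    (hinj : Function.Injective (fderiv ℝ ψ 0)) :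
    ∃ p : OpenPartialHomeomorph (EuclideanSpace ℝ (Fin m)) (EuclideanSpace ℝ (Fin m)),
      0 ∈ p.source ∧ (∀ z, p z = ψ z) ∧ ContDiffOn ℝ ∞ p.symm p.target := by
  let L : EuclideanSpace ℝ (Fin m) ≃L[ℝ] EuclideanSpace ℝ (Fin m) :=
    (LinearEquiv.ofInjectiveEndo (fderiv ℝ ψ 0 : EuclideanSpace ℝ (Fin m) →ₗ[ℝ] _)
      hinj).toContinuousLinearEquiv
  have hL : (L : EuclideanSpace ℝ (Fin m) →L[ℝ] EuclideanSpace ℝ (Fin m)) = fderiv ℝ ψ 0 := by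
    ext v; rfl
  have hder : HasFDerivAt ψ (L : EuclideanSpace ℝ (Fin m) →L[ℝ] EuclideanSpace ℝ (Fin m)) 0 := by
    rw [hL]; exact (hψ.differentiable (by simp) 0).hasFDerivAt
  let p₀ := hψ.contDiffAt.toOpenPartialHomeomorph ψ hder (by simp)
  -- Restricting to points where the derivative is invertible makes the local inverse smooth on its
  -- whole target, as membership in the maximal atlas demands.
  let s : Set (EuclideanSpace ℝ (Fin m)) := fderiv ℝ ψ ⁻¹' Set.range
    ((↑) : (EuclideanSpace ℝ (Fin m) ≃L[ℝ] EuclideanSpace ℝ (Fin m)) → _)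
  have hs : IsOpen s := ContinuousLinearEquiv.isOpen.preimage (hψ.continuous_fderiv (by simp))
  have h0 : (0 : EuclideanSpace ℝ (Fin m)) ∈ p₀.source :=
    hψ.contDiffAt.mem_toOpenPartialHomeomorph_source hder (by simp)
  refine ⟨p₀.restrOpen s hs, ⟨h0, ⟨L, hL⟩⟩, fun z => rfl, fun z hz => ?_⟩
  have hmem := (p₀.restrOpen s hs).map_target hz
  obtain ⟨L', hL'⟩ : (p₀.restrOpen s hs).symm z ∈ s := by
    rw [OpenPartialHomeomorph.restrOpen_source] at hmem; exact hmem.2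
  refine ((p₀.restrOpen s hs).contDiffAt_symm hz (f₀' := L') ?_ hψ.contDiffAt).contDiffWithinAt
  rw [hL']
  exact (hψ.differentiable (by simp) _).hasFDerivAt

variable {M : Type*} [TopologicalSpace M] [ChartedSpace (EuclideanSpace ℝ (Fin m)) M]
  [IsManifold (𝓡 m) ∞ M]

/-- A smooth map with injective derivative at `0` provides a change of chart. -/
theorem exists_chart_of_change {e : OpenPartialHomeomorph M (EuclideanSpace ℝ (Fin m))}
    (he : e ∈ maximalAtlas (𝓡 m) ∞ M) {x : M} (hx : x ∈ e.source)
    {ψ : EuclideanSpace ℝ (Fin m) → EuclideanSpace ℝ (Fin m)} (hψ : ContDiff ℝ ∞ ψ)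
    (hinj : Function.Injective (fderiv ℝ ψ 0)) (h0 : ψ 0 = e x) :
    ∃ e' ∈ maximalAtlas (𝓡 m) ∞ M, x ∈ e'.source ∧ e' x = 0 ∧
      ∀ z ∈ e'.target, e'.symm z ∈ e.source ∧ e (e'.symm z) = ψ z := by
  obtain ⟨p, hp0, hp, hps⟩ := exists_openPartialHomeomorph hψ hinj
  have hpx : e x = p 0 := by rw [hp, h0]
  refine ⟨e.trans p.symm, ?_, ?_, ?_, ?_⟩
  · refine OpenPartialHomeomorph.mem_maximalAtlas_of_contMDiffOn _ ?_ ?_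
    · refine (contMDiffOn_iff_contDiffOn.mpr hps).comp
        ((contMDiffOn_of_mem_maximalAtlas he).mono ?_) ?_
      · intro z hz; simp at hz; exact hz.1
      · intro z hz; simp at hz; exact hz.2
    · have hpsm : ContMDiffOn (𝓡 m) (𝓡 m) ∞ p (e.trans p.symm).target :=
        contMDiffOn_iff_contDiffOn.mpr (hψ.contDiffOn.congr fun z _ => hp z)
      refine (contMDiffOn_symm_of_mem_maximalAtlas he).comp hpsm ?_
      intro z hz; simp at hz; exact hz.2
  · simp only [OpenPartialHomeomorph.trans_source, Set.mem_inter_iff, Set.mem_preimage,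
      OpenPartialHomeomorph.symm_source]
    exact ⟨hx, hpx ▸ p.map_source hp0⟩
  · simp only [OpenPartialHomeomorph.coe_trans, Function.comp]
    rw [hpx, p.left_inv hp0]
  · intro z hz
    simp at hz
    have : (e.trans p.symm).symm z = e.symm (p z) := rfl
    rw [this, ← hp]
    exact ⟨e.map_target hz.2, e.right_inv hz.2⟩

-- If G = CᵀC, the columns of C⁻¹ are orthonormal for G.
open scoped MatrixOrder in
theorem exists_orthonormal_frame {G : Matrix (Fin m) (Fin m) ℝ} (hG : G.PosDef) :
    ∃ A : Matrix (Fin m) (Fin m) ℝ, IsUnit A.det ∧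
      ∀ i j, ∑ a, ∑ b, G a b * (A a i * A b j) = (1 : Matrix (Fin m) (Fin m) ℝ) i j := by
  obtain ⟨C, hC⟩ := CStarAlgebra.nonneg_iff_eq_star_mul_self.mp hG.posSemidef.nonneg
  have hCd : IsUnit C.det := by
    rw [isUnit_iff_ne_zero]
    intro h0
    have := hG.det_pos.ne'
    rw [hC, Matrix.det_mul, h0, mul_zero] at this
    exact this rfl
  refine ⟨C⁻¹, Matrix.isUnit_nonsing_inv_det C hCd, fun i j => ?_⟩
  have h1 : (C⁻¹).transpose * G * C⁻¹ = 1 := by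
    have hs : star C = C.transpose := by ext; simp [Matrix.star_apply]
    have hCt : IsUnit C.transpose.det := by rwa [Matrix.det_transpose]
    rw [hC, hs, Matrix.transpose_nonsing_inv, ← Matrix.mul_assoc, Matrix.nonsing_inv_mul _ hCt,
      Matrix.one_mul, Matrix.mul_nonsing_inv _ hCd]
  rw [← h1]
  simp only [Matrix.mul_apply, Matrix.transpose_apply, Finset.sum_mul]
  rw [Finset.sum_comm]
  exact Finset.sum_congr rfl fun a _ => Finset.sum_congr rfl fun b _ => by ring

/-- The polynomial map `z ↦ y + A z - ½ B(z, z)`. -/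
def quadMap (y : EuclideanSpace ℝ (Fin m)) (A : Matrix (Fin m) (Fin m) ℝ)
    (B : Fin m → Fin m → Fin m → ℝ) (z : EuclideanSpace ℝ (Fin m)) :
    EuclideanSpace ℝ (Fin m) :=
  WithLp.toLp 2 fun a => y a + (∑ i, A a i * z i - (1 / 2) * ∑ i, ∑ j, B a i j * (z i * z j))

theorem contDiff_quadMap (y : EuclideanSpace ℝ (Fin m)) (A : Matrix (Fin m) (Fin m) ℝ)
    (B : Fin m → Fin m → Fin m → ℝ) : ContDiff ℝ ∞ (quadMap y A B) := by
  rw [contDiff_euclidean]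
  intro a
  have hc := contDiff_coord_apply (m := m)
  exact contDiff_const.add ((ContDiff.sum fun i _ => contDiff_const.mul (hc i)).sub
    (contDiff_const.mul (ContDiff.sum fun i _ => ContDiff.sum fun j _ =>
      contDiff_const.mul ((hc i).mul (hc j)))))

theorem pd_quadMap (y : EuclideanSpace ℝ (Fin m)) (A : Matrix (Fin m) (Fin m) ℝ)
    {B : Fin m → Fin m → Fin m → ℝ} (hB : ∀ a i j, B a i j = B a j i)
    (z : EuclideanSpace ℝ (Fin m)) (k a : Fin m) :
    pd k (fun z => quadMap y A B z a) z = A a k - ∑ j, B a k j * z j := by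
  have hc := contDiff_coord_apply (m := m)
  have hd : ∀ {K : EuclideanSpace ℝ (Fin m) → ℝ}, ContDiff ℝ ∞ K → DifferentiableAt ℝ K z :=
    fun h => (h.differentiable (by simp)) z
  have s1 : ∀ i, ContDiff ℝ ∞ fun z : EuclideanSpace ℝ (Fin m) => A a i * z i :=
    fun i => contDiff_const.mul (hc i)
  have s2 : ∀ i j, ContDiff ℝ ∞ fun z : EuclideanSpace ℝ (Fin m) => B a i j * (z i * z j) :=
    fun i j => contDiff_const.mul ((hc i).mul (hc j))
  have s3 : ∀ i, ContDiff ℝ ∞ fun z : EuclideanSpace ℝ (Fin m) => ∑ j, B a i j * (z i * z j) :=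
    fun i => ContDiff.sum fun j _ => s2 i j
  have s4 := ContDiff.sum fun i (_ : i ∈ Finset.univ) => s1 i
  have s5 := ContDiff.sum fun i (_ : i ∈ Finset.univ) => s3 i
  have e1 : pd k (fun z => ∑ i, A a i * z i) z = A a k := by
    rw [pd_sum _ fun i _ => hd (s1 i)]
    simp [pd_const_mul (hd (hc _)), pd_coord]
  have e2 : pd k (fun z => ∑ i, ∑ j, B a i j * (z i * z j)) z = 2 * ∑ j, B a k j * z j := by
    rw [pd_sum _ fun i _ => hd (s3 i)]
    have : ∀ i, pd k (fun z => ∑ j, B a i j * (z i * z j)) z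
        = (if k = i then ∑ j, B a i j * z j else 0) + B a i k * z i := by
      intro i
      rw [pd_sum _ fun j _ => hd (s2 i j)]
      simp only [pd_const_mul (hd ((hc i).mul (hc _))), pd_mul (hd (hc i)) (hd (hc _)), pd_coord,
        mul_add, Finset.sum_add_distrib]
      split_ifs <;> simp
    simp only [this, Finset.sum_add_distrib]
    simp [hB a _ k]
    ring
  change pd k (fun z => y a + (∑ i, A a i * z i - (1 / 2) * ∑ i, ∑ j, B a i j * (z i * z j))) z = _
  rw [pd_add (hd contDiff_const) (hd (s4.sub (contDiff_const.mul s5))),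
    pd_sub (hd s4) (hd (contDiff_const.mul s5)), pd_const_mul (hd s5), e1, e2, pd_const]
  ring

theorem pd_pd_quadMap (y : EuclideanSpace ℝ (Fin m)) (A : Matrix (Fin m) (Fin m) ℝ)
    {B : Fin m → Fin m → Fin m → ℝ} (hB : ∀ a i j, B a i j = B a j i)
    (z : EuclideanSpace ℝ (Fin m)) (l k a : Fin m) :
    pd l (pd k (fun z => quadMap y A B z a)) z = - B a k l := by
  have hc := contDiff_coord_apply (m := m)
  have hd : ∀ {K : EuclideanSpace ℝ (Fin m) → ℝ}, ContDiff ℝ ∞ K → DifferentiableAt ℝ K z :=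
    fun h => (h.differentiable (by simp)) z
  have s1 : ∀ i, ContDiff ℝ ∞ fun z : EuclideanSpace ℝ (Fin m) => B a k i * z i :=
    fun i => contDiff_const.mul (hc i)
  have : pd k (fun z => quadMap y A B z a) = fun z => A a k - ∑ j, B a k j * z j := by
    ext z; exact pd_quadMap y A hB z k a
  rw [this, pd_sub (hd contDiff_const) (hd (ContDiff.sum fun i _ => s1 i)), pd_const,
    pd_sum _ fun i _ => hd (s1 i)]
  simp [pd_const_mul (hd (hc _)), pd_coord]

theorem christoffel_symm {G : EuclideanSpace ℝ (Fin m) → Matrix (Fin m) (Fin m) ℝ}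
    {V : Set (EuclideanSpace ℝ (Fin m))} (hG : SmoothMetricOn G V)
    {y : EuclideanSpace ℝ (Fin m)} (hy : y ∈ V) (k i j : Fin m) :
    christoffel G k i j y = christoffel G k j i y := by
  unfold christoffel
  congr 1
  refine Finset.sum_congr rfl fun l _ => ?_
  rw [pd_congr hG.isOpen hy (fun z hz => hG.symm z hz i j) l]
  ring

theorem sum_mul_christoffel {G : EuclideanSpace ℝ (Fin m) → Matrix (Fin m) (Fin m) ℝ}
    {V : Set (EuclideanSpace ℝ (Fin m))} (hG : SmoothMetricOn G V)
    {y : EuclideanSpace ℝ (Fin m)} (hy : y ∈ V) (b i j : Fin m) :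
    ∑ a, G y a b * christoffel G a i j y = (1 / 2) * lowerChristoffel G i j b y := by
  simp only [christoffel_eq_lower, Finset.mul_sum]
  rw [Finset.sum_comm]
  have : ∀ l, ∑ a, G y a b * (1 / 2 * ((G y)⁻¹ a l * lowerChristoffel G i j l y))
      = (1 / 2) * ((1 : Matrix (Fin m) (Fin m) ℝ) b l * lowerChristoffel G i j l y) := by
    intro l
    rw [← Matrix.mul_nonsing_inv _ (isUnit_iff_ne_zero.mpr (hG.det_ne y hy)), Matrix.mul_apply,
      Finset.sum_mul, Finset.mul_sum]
    exact Finset.sum_congr rfl fun a _ => by rw [hG.symm y hy a b]; ring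
  rw [Finset.sum_congr rfl fun l _ => this l]
  simp [Matrix.one_apply]

/-- Around each point there is a chart in which the metric is the identity to first order. -/
theorem exists_normal_chart (g : Metric m M) (x : M) :
    ∃ e ∈ maximalAtlas (𝓡 m) ∞ M, x ∈ e.source ∧ NormalAt (metricCoeff g e) e.target (e x) := by
  let e₀ := chartAt (EuclideanSpace ℝ (Fin m)) x
  have he₀ : e₀ ∈ maximalAtlas (𝓡 m) ∞ M := chart_mem_maximalAtlas _
  have hx₀ : x ∈ e₀.source := mem_chart_source _ x
  let G := metricCoeff g e₀
  let y := e₀ x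
  have hy : y ∈ e₀.target := e₀.map_source hx₀
  have hG : SmoothMetricOn G e₀.target := smoothMetricOn_metricCoeff g he₀
  obtain ⟨A, hA, hAG⟩ := exists_orthonormal_frame (posDef_metricCoeff g he₀ hy)
  -- The chart is the inverse of z ↦ y + Az - ½Γ(Az, Az): A orthonormalises the metric at y, and the
  -- quadratic term is the one that cancels its first derivatives.
  let B : Fin m → Fin m → Fin m → ℝ :=
    fun a i j => ∑ p, ∑ q, christoffel G a p q y * (A p i * A q j)
  have hB : ∀ a i j, B a i j = B a j i := by
    intro a i j
    simp only [B]
    rw [Finset.sum_comm]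
    exact Finset.sum_congr rfl fun p _ => Finset.sum_congr rfl fun q _ => by
      rw [christoffel_symm hG hy]; ring
  let ψ := quadMap y A B
  have hψ : ContDiff ℝ ∞ ψ := contDiff_quadMap y A B
  have hψ0 : ψ 0 = y := by ext a; simp [ψ, quadMap]
  have hpd : ∀ a i, pd i (fun z => ψ z a) 0 = A a i := fun a i => by
    rw [pd_quadMap y A hB]; simp
  have hinj : Function.Injective (fderiv ℝ ψ 0) := by
    rw [injective_iff_map_eq_zero]
    intro v hv
    have h1 : A.mulVec v = 0 := by
      ext a
      have h2 : fderiv ℝ ψ 0 v a = ∑ i, A a i * v i := by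
        have h3 := ((EuclideanSpace.proj a : EuclideanSpace ℝ (Fin m) →L[ℝ] ℝ).hasFDerivAt.comp 0
          (hψ.differentiable (by simp) 0).hasFDerivAt).fderiv
        have h4 : fderiv ℝ ψ 0 v a = fderiv ℝ (fun z => ψ z a) 0 v := by
          change _ = fderiv ℝ ((EuclideanSpace.proj a : EuclideanSpace ℝ (Fin m) →L[ℝ] ℝ) ∘ ψ) 0 v
          rw [h3]; rfl
        rw [h4, fderiv_eq_sum_pd]
        exact Finset.sum_congr rfl fun i _ => by rw [hpd, mul_comm]
      simp only [Matrix.mulVec, dotProduct, Pi.zero_apply]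
      rw [← h2, hv]; rfl
    have h2 : (v : Fin m → ℝ) = 0 := by
      have := Matrix.mulVec_injective_of_isUnit ((Matrix.isUnit_iff_isUnit_det A).mpr hA)
      exact this (by rw [h1, Matrix.mulVec_zero])
    ext i; exact congrFun h2 i
  obtain ⟨e, he, hxe, hex, hee⟩ := exists_chart_of_change he₀ hx₀ hψ hinj hψ0
  have h0 : (0 : EuclideanSpace ℝ (Fin m)) ∈ e.target := hex ▸ e.map_source hxe
  have hm : Set.MapsTo ψ e.target e₀.target := fun z hz => by
    rw [← (hee z hz).2]; exact e₀.map_source (hee z hz).1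
  have hch := isChange_chart g he₀ he
  have hcoef : ∀ z ∈ e.target, ∀ i j, metricCoeff g e z i j = pullbackMatrix G ψ i j z := by
    intro z hz i j
    rw [hch.eq z ⟨hz, (hee z hz).1⟩]
    unfold pullbackMatrix
    have hz2 : (e₀ ∘ e.symm) z = ψ z := (hee z hz).2
    have hpd' : ∀ k a, pd k (fun w => (e₀ ∘ e.symm) w a) z = pd k (fun w => ψ w a) z :=
      fun k a => pd_congr e.open_target hz (fun w hw => by
        change (e₀ (e.symm w)) a = _; rw [(hee w hw).2]) k
    simp only [hz2, hpd']
    rfl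
  refine ⟨e, he, hxe, { smoothMetricOn_metricCoeff g he with
    mem := e.map_source hxe
    eq_one := ?_
    pd_eq_zero := ?_ }⟩
  · rw [hex]
    ext i j
    rw [hcoef 0 h0, pullbackMatrix]
    simp only [hpd, hψ0]
    exact hAG i j
  · intro k i j
    rw [hex, pd_congr e.open_target h0 (fun z hz => hcoef z hz i j) k,
      pd_pullbackMatrix hG e.open_target hψ.contDiffOn hm h0]
    have hpd2 : ∀ l k a, pd l (pd k (fun z => ψ z a)) 0 = - B a l k := fun l k a => by
      rw [pd_pd_quadMap y A hB, hB]
    simp only [hpd, hpd2, hψ0]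
    -- Lowering the index of Γ expresses each second-derivative term through `lowerChristoffel`.
    have key : ∀ i j, ∑ a, ∑ b, G y a b * (-B a k i * A b j)
        = - ((1 / 2) * ∑ p, ∑ q, ∑ b, A p k * A q i * A b j * lowerChristoffel G p q b y) := by
      intro i j
      have h1 : ∀ b, ∑ a, G y a b * B a k i
          = ∑ p, ∑ q, (1 / 2) * lowerChristoffel G p q b y * (A p k * A q i) := by
        intro b
        simp only [← sum_mul_christoffel hG hy, B, Finset.mul_sum, Finset.sum_mul]
        rw [Finset.sum_comm]
        refine Finset.sum_congr rfl fun p _ => ?_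
        rw [Finset.sum_comm]
        exact Finset.sum_congr rfl fun q _ => Finset.sum_congr rfl fun a _ => by ring
      calc _ = - ∑ b, (∑ a, G y a b * B a k i) * A b j := by
            rw [Finset.sum_comm, ← Finset.sum_neg_distrib]
            refine Finset.sum_congr rfl fun b _ => ?_
            rw [Finset.sum_mul, ← Finset.sum_neg_distrib]
            exact Finset.sum_congr rfl fun a _ => by ring
        _ = _ := by
            congr 1
            simp only [h1, Finset.sum_mul, Finset.mul_sum]
            rw [Finset.sum_comm]
            refine Finset.sum_congr rfl fun p _ => ?_
            rw [Finset.sum_comm]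
            exact Finset.sum_congr rfl fun q _ => Finset.sum_congr rfl fun b _ => by ring
    have key2 : ∑ p, ∑ q, ∑ b, A p k * A q j * A b i * lowerChristoffel G p q b y
        = ∑ p, ∑ q, ∑ b, A p k * A q i * A b j * lowerChristoffel G p b q y := by
      refine Finset.sum_congr rfl fun p _ => ?_
      rw [Finset.sum_comm]
      exact Finset.sum_congr rfl fun q _ => Finset.sum_congr rfl fun b _ => by ring
    -- Metric compatibility: these two symbols add up to the derivative of the metric, which is what
    -- the quadratic correction must cancel.
    have key3 : ∀ p q b, lowerChristoffel G p q b y + lowerChristoffel G p b q y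
        = 2 * pd p (fun z => G z q b) y := by
      intro p q b
      unfold lowerChristoffel
      rw [pd_congr hG.isOpen hy (fun z hz => hG.symm z hz b q) p]
      ring
    rw [key i j, key j i, key2]
    have key4 : ∑ p, ∑ q, ∑ b, A p k * A q i * A b j * pd p (fun z => G z q b) y
        = (1 / 2) * ∑ p, ∑ q, ∑ b, A p k * A q i * A b j * lowerChristoffel G p q b y
        + (1 / 2) * ∑ p, ∑ q, ∑ b, A p k * A q i * A b j * lowerChristoffel G p b q y := by
      simp only [Finset.mul_sum, ← Finset.sum_add_distrib]
      refine Finset.sum_congr rfl fun p _ => Finset.sum_congr rfl fun q _ =>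
        Finset.sum_congr rfl fun b _ => ?_
      linear_combination (-(1 / 2) * (A p k * A q i * A b j)) * key3 p q b
    rw [key4]
    ring

end NormalCoordinates

/-! Gradient almost Ricci-harmonic solitons. -/

section Soliton

open IsManifold

variable {m n : ℕ}
  {M : Type*} [TopologicalSpace M] [ChartedSpace (EuclideanSpace ℝ (Fin m)) M]
  [IsManifold (𝓡 m) ∞ M]
  {N : Type*} [TopologicalSpace N] [ChartedSpace (EuclideanSpace ℝ (Fin n)) N]
  [IsManifold (𝓡 n) ∞ N]

/-- This puts the Laplacian in the form to which the Euclidean minimum principle applies. -/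
theorem metricTrace_hess_eq_secondOrder
    (G : EuclideanSpace ℝ (Fin m) → Matrix (Fin m) (Fin m) ℝ) (F : EuclideanSpace ℝ (Fin m) → ℝ)
    (y : EuclideanSpace ℝ (Fin m)) :
    metricTrace G (fun i j => hess G F i j y) y
      = secondOrder (fun z => (G z)⁻¹)
        (fun k z => -∑ i, ∑ j, (G z)⁻¹ i j * christoffel G k i j z) F y := by
  simp only [metricTrace, hess, secondOrder, mul_sub, Finset.sum_sub_distrib, neg_mul,
    Finset.sum_neg_distrib, ← sub_eq_add_neg]
  congr 1
  simp only [Finset.mul_sum, Finset.sum_mul]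
  conv_rhs => rw [Finset.sum_comm]
  refine Finset.sum_congr rfl fun i _ => ?_
  rw [Finset.sum_comm]
  exact Finset.sum_congr rfl fun k _ => Finset.sum_congr rfl fun j _ => by ring

/-- On a compact connected manifold superharmonic functions are constant. -/
theorem exists_eq_const_of_laplacian_nonpos [CompactSpace M] [ConnectedSpace M] (g : Metric m M)
    {F : M → ℝ} (hF : ContMDiff (𝓡 m) 𝓘(ℝ, ℝ) ∞ F) (hΔ : ∀ x, laplacian g F x ≤ 0) :
    ∃ c : ℝ, ∀ x, F x = c := by
  obtain ⟨x₀, -, hx₀⟩ := isCompact_univ.exists_isMinOn Set.univ_nonempty hF.continuous.continuousOn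
  have hmin : ∀ z, F x₀ ≤ F z := fun z => hx₀ (Set.mem_univ z)
  -- The set where the minimum is attained is closed by continuity and open by Hopf's principle, so
  -- connectedness finishes.
  have hopen : IsOpen {x | F x = F x₀} := by
    rw [isOpen_iff_mem_nhds]
    intro x hx
    set e := chartAt (EuclideanSpace ℝ (Fin m)) x with hedef
    have he : e ∈ maximalAtlas (𝓡 m) ∞ M := chart_mem_maximalAtlas _
    have hxe : x ∈ e.source := mem_chart_source _ x
    have hG := smoothMetricOn_metricCoeff g he
    have hFe := contDiffOn_comp_chart_symm hF he
    have hxx : (F ∘ e.symm) (e x) = F x₀ := by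
      rw [Function.comp, e.left_inv hxe]; exact hx
    have hloc := eventually_eq_of_secondOrder_nonpos (A := fun z => (metricCoeff g e z)⁻¹)
      (b := fun k z => -∑ i, ∑ j, (metricCoeff g e z)⁻¹ i j * christoffel (metricCoeff g e) k i j z)
      hG.isOpen (e.map_source hxe) hFe (fun z hz => (posDef_metricCoeff g he hz).inv)
      (fun i j => (hG.contDiffOn_inv i j).continuousOn)
      (fun k => (continuousOn_finsetSum _ fun i _ => continuousOn_finsetSum _ fun j _ =>
        ((hG.contDiffOn_inv i j).mul (hG.contDiffOn_christoffel k i j)).continuousOn).neg)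
      (fun z hz => by
        rw [← metricTrace_hess_eq_secondOrder, ← laplacian_eq g hF he hz]; exact hΔ _)
      (fun z _ => by rw [hxx]; exact hmin _)
    filter_upwards [(e.continuousAt hxe).eventually hloc, e.open_source.mem_nhds hxe] with z hz hze
    rw [hxx, Function.comp, e.left_inv hze] at hz
    exact hz
  have hclopen : IsClopen {x | F x = F x₀} :=
    ⟨isClosed_eq hF.continuous continuous_const, hopen⟩
  have huniv := hclopen.eq_univ ⟨x₀, rfl⟩
  exact ⟨F x₀, fun x => (huniv ▸ Set.mem_univ x : x ∈ {x | F x = F x₀})⟩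

theorem NormalAt.mono {G : EuclideanSpace ℝ (Fin m) → Matrix (Fin m) (Fin m) ℝ}
    {W W' : Set (EuclideanSpace ℝ (Fin m))} {y : EuclideanSpace ℝ (Fin m)} (hG : NormalAt G W y)
    (hW' : IsOpen W') (hsub : W' ⊆ W) (hy : y ∈ W') : NormalAt G W' y where
  isOpen := hW'
  smooth i j := (hG.smooth i j).mono hsub
  symm z hz := hG.symm z (hsub hz)
  det_ne z hz := hG.det_ne z (hsub hz)
  mem := hy
  eq_one := hG.eq_one
  pd_eq_zero := hG.pd_eq_zero

/-- The sum is the squared length of the image under du of the vector with components v. -/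
theorem sum_pullbackCoeff_nonneg (h : Metric n N) (u : M → N)
    (e : OpenPartialHomeomorph M (EuclideanSpace ℝ (Fin m))) (y : EuclideanSpace ℝ (Fin m))
    (v : Fin m → ℝ) : 0 ≤ ∑ i, ∑ j, pullbackCoeff h u e i j y * v i * v j := by
  let w := ∑ i, v i • mfderiv (𝓡 m) (𝓡 n) u (e.symm y) (coordVec e i y)
  have h1 : ∑ i, ∑ j, pullbackCoeff h u e i j y * v i * v j = h.inner (u (e.symm y)) w w := by
    simp only [w, map_sum, map_smul, sum_apply, smul_apply, smul_eq_mul]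
    rw [Finset.sum_comm]
    refine Finset.sum_congr rfl fun i _ => ?_
    rw [Finset.mul_sum]
    exact Finset.sum_congr rfl fun j _ => by unfold pullbackCoeff; ring
  rw [h1]
  by_cases hw : w = 0
  · simp [hw]
  · exact (h.pos _ _ hw).le

/-- `ΔF - |∇F|² + 2 c F`. -/
def hamilton (g : Metric m M) (c : ℝ) (F : M → ℝ) (x : M) : ℝ :=
  laplacian g F x - gradSq g F x + 2 * c * F x

variable {g : Metric m M} {h : Metric n N} {α c : ℝ} {u : M → N} {f σ : M → ℝ}

theorem IsGradientAlmostSoliton.ricci_eq_of_mem_target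
    (hsol : IsGradientAlmostSoliton g h α u f σ) (hσ : ∀ x, σ x = c)
    {e : OpenPartialHomeomorph M (EuclideanSpace ℝ (Fin m))}
    (he : e ∈ maximalAtlas (𝓡 m) ∞ M) {z : EuclideanSpace ℝ (Fin m)} (hz : z ∈ e.target)
    (i j : Fin m) : ricci (metricCoeff g e) i j z - α * pullbackCoeff h u e i j z
      + hess (metricCoeff g e) (f ∘ e.symm) i j z = c * metricCoeff g e z i j := by
  have := hsol.ricci_eq e he (e.symm z) (e.map_target hz) i j
  rwa [e.right_inv hz, hσ, scCoeff] at this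

theorem contMDiff_hamilton (hf : ContMDiff (𝓡 m) 𝓘(ℝ, ℝ) ∞ f) :
    ContMDiff (𝓡 m) 𝓘(ℝ, ℝ) ∞ (hamilton g c f) :=
  ((contMDiff_laplacian g hf).sub (contMDiff_gradSq g hf)).add (contMDiff_const.mul hf)

/-- The derivative must vanish on the whole chart, not only at a centre, so that it can be
differentiated again. Each point therefore gets its own normal charts in M and N. -/
theorem IsGradientAlmostSoliton.pd_hamilton_eq_zero
    (hsol : IsGradientAlmostSoliton g h α u f σ) (hσ : ∀ x, σ x = c)
    {e : OpenPartialHomeomorph M (EuclideanSpace ℝ (Fin m))}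
    (he : e ∈ maximalAtlas (𝓡 m) ∞ M) {z : EuclideanSpace ℝ (Fin m)} (hz : z ∈ e.target)
    (i : Fin m) : pd i (hamilton g c f ∘ e.symm) z = 0 := by
  set x := e.symm z with hx
  have hf := hsol.smooth_potential
  have hu := hsol.smooth_map
  obtain ⟨e₁, he₁, hxe₁, hN⟩ := exists_normal_chart g x
  obtain ⟨d, hd, hxd, hNd⟩ := exists_normal_chart h (u x)
  -- criticality in the normal chart
  have hcrit : ∀ a, pd a (hamilton g c f ∘ e₁.symm) (e₁ x) = 0 := by
    intro a
    -- The domain is shrunk so that u takes values in a single normal chart of N.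
    set W := e₁.target ∩ e₁.symm ⁻¹' (u ⁻¹' d.source) with hWdef
    have hW : IsOpen W := isOpen_chart_expression hu
    have hxW : e₁ x ∈ W := ⟨e₁.map_source hxe₁, by
      simp only [Set.mem_preimage, e₁.left_inv hxe₁]; exact hxd⟩
    have hN' := hN.mono hW Set.inter_subset_left hxW
    have hU := contDiffOn_chart_expression hu he₁ hd
    have hm : Set.MapsTo (d ∘ u ∘ e₁.symm) W d.target := fun z hz => d.map_source hz.2
    have hUx : (d ∘ u ∘ e₁.symm) (e₁ x) = d (u x) := by
      simp only [Function.comp, e₁.left_inv hxe₁]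
    have hNd' : NormalAt (metricCoeff h d) d.target ((d ∘ u ∘ e₁.symm) (e₁ x)) := by
      rw [hUx]; exact hNd
    have hF : ContDiffOn ℝ ∞ (f ∘ e₁.symm) W :=
      (contDiffOn_comp_chart_symm hf he₁).mono Set.inter_subset_left
    have htau : ∀ b, ∑ j, pd j (pd j (fun z => (d ∘ u ∘ e₁.symm) z b)) (e₁ x)
        = ∑ k, pd k (fun z => (d ∘ u ∘ e₁.symm) z b) (e₁ x) * pd k (f ∘ e₁.symm) (e₁ x) := by
      intro b
      have ht := hsol.tension_eq e₁ he₁ d hd x hxe₁ hxd b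
      rw [tension, gradInner, hN.metricTrace_eq, hN.metricTrace_eq, sub_eq_zero] at ht
      simp only [hN.hess_eq, hNd'.christoffel_eq_zero, zero_mul, Finset.sum_const_zero,
        add_zero] at ht
      exact ht
    have key := hN'.pd_hamilton_eq_zero hF (c := c) (α := α)
      (contDiffOn_pullbackMatrix hNd'.toSmoothMetricOn hW hU hm)
      (fun z hz i j => by
        rw [← pullbackCoeff_eq h hu he₁ hd hz]
        exact hsol.ricci_eq_of_mem_target hσ he₁ hz.1 i j)
      (hNd'.div_pullbackMatrix hW hU hm hxW htau) a
    rw [← key]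
    refine pd_congr hW hxW (fun z hz => ?_) a
    simp only [Function.comp, hamilton, laplacian_eq g hf he₁ hz.1, gradSq_eq g hf he₁ hz.1]
  -- The chain rule transfers criticality from the normal chart to the given one.
  have hch := isChange_chart g he₁ he
  have hzW : z ∈ e.target ∩ e.symm ⁻¹' e₁.source := ⟨hz, hxe₁⟩
  have h1 := hch.pd_comp hzW
    (contDiffOn_comp_chart_symm (contMDiff_hamilton (g := g) (c := c) hf) he₁) i
  have h2 : (e₁ ∘ e.symm) z = e₁ x := rfl
  rw [pd_congr hch.right.isOpen hzW (K := hamilton g c f ∘ e.symm) (fun w hw => by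
    simp only [Function.comp]; rw [e₁.left_inv hw.2]) i] at h1
  rw [h1, h2]
  simp [hcrit]

theorem pd_pd_nonpos_of_isLocalMax {W : Set (EuclideanSpace ℝ (Fin m))}
    {y : EuclideanSpace ℝ (Fin m)} {F : EuclideanSpace ℝ (Fin m) → ℝ} (hW : IsOpen W) (hy : y ∈ W)
    (hF : ContDiffOn ℝ ∞ F W) (h : IsLocalMax F y) (k : Fin m) : pd k (pd k F) y ≤ 0 := by
  have h1 : IsLocalMin (fun z => (-1) * F z) y := by
    simpa using h.neg
  have h2 := hessian_nonneg_of_isLocalMin hW hy (contDiffOn_const.mul hF) h1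
    (fun i => if i = k then 1 else 0)
  simp only [pd_pd_const_mul hW hy hF] at h2
  simp at h2
  linarith

/-- The maximum of `Δf` is not positive. -/
theorem IsGradientAlmostSoliton.laplacian_nonpos_of_isMax (hα : 0 ≤ α)
    (hsol : IsGradientAlmostSoliton g h α u f σ) (hσ : ∀ x, σ x = c) (hc : c ≤ 0) {x : M}
    (hmax : ∀ z, laplacian g f z ≤ laplacian g f x) : laplacian g f x ≤ 0 := by
  by_contra! hpos
  have hf := hsol.smooth_potential
  obtain ⟨e, he, hxe, hN⟩ := exists_normal_chart g x
  set y := e x with hydef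
  set G := metricCoeff g e with hGdef
  set F := f ∘ e.symm with hFdef
  have hy := hN.mem
  have hF : ContDiffOn ℝ ∞ F e.target := contDiffOn_comp_chart_symm hf he
  let D : EuclideanSpace ℝ (Fin m) → ℝ := fun z => metricTrace G (fun i j => hess G F i j z) z
  have hD : ContDiffOn ℝ ∞ D e.target := contDiffOn_metricTrace hN.smooth hN.det_ne
    (contDiffOn_hess hN.isOpen hN.smooth hN.det_ne hF)
  have hS : ContDiffOn ℝ ∞ (gradInner G F F) e.target :=
    contDiffOn_gradInner hN.isOpen hN.smooth hN.det_ne hF hF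
  have hDe : ∀ z ∈ e.target, laplacian g f (e.symm z) = D z := fun z hz => laplacian_eq g hf he hz
  have hxy : e.symm y = x := e.left_inv hxe
  have hDy : laplacian g f x = D y := by rw [← hDe y hy, hxy]
  have hDmax : IsLocalMax D y := by
    filter_upwards [hN.isOpen.mem_nhds hy] with z hz
    rw [← hDe z hz, ← hDe y hy, hxy]; exact hmax _
  have hD1 : ∀ i, pd i D y = 0 := fun i => by simp [pd, hDmax.fderiv_eq_zero]
  have hD2 : ∑ k, pd k (pd k D) y ≤ 0 := Finset.sum_nonpos fun k _ =>
    pd_pd_nonpos_of_isLocalMax hN.isOpen hy hD hDmax k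
  have hQ : ∀ z ∈ e.target, ∀ i, pd i (fun z => D z - gradInner G F F z + 2 * c * F z) z = 0 := by
    intro z hz i
    rw [← hsol.pd_hamilton_eq_zero hσ he hz i]
    refine pd_congr hN.isOpen hz (fun w hw => ?_) i
    simp only [Function.comp, hamilton, laplacian_eq g hf he hw, gradSq_eq g hf he hw]
    rfl
  have hDS := hD.sub hS
  have hcF : ContDiffOn ℝ ∞ (fun z => 2 * c * F z) e.target := contDiffOn_const.mul hF
  -- At the maximum dΔf = 0, so dQ = 0 reduces to Hess f(∇f) = c∇f.
  have hQ1 : ∀ i, ∑ k, pd i (pd k F) y * pd k F y = c * pd i F y := by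
    intro i
    have := hQ y hy i
    rw [pd_add (diffAt hN.isOpen hy hDS) (diffAt hN.isOpen hy hcF),
      pd_sub (diffAt hN.isOpen hy hD) (diffAt hN.isOpen hy hS),
      pd_const_mul (diffAt hN.isOpen hy hF), hD1, hN.pd_gradInner_self hF] at this
    linarith
  have hQ2 : ∀ k, pd k (pd k D) y - pd k (pd k (gradInner G F F)) y + 2 * c * pd k (pd k F) y
      = 0 := by
    intro k
    have := pd_congr hN.isOpen hy (fun z hz => hQ z hz k) k
    rwa [pd_const, pd_pd_add hN.isOpen hy hDS hcF, pd_pd_sub hN.isOpen hy hD hS,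
      pd_pd_const_mul hN.isOpen hy hF] at this
  have hDyF : D y = ∑ k, pd k (pd k F) y := by
    simp only [D, hN.metricTrace_eq, hN.hess_eq]
  have hsum : ∑ k, pd k (pd k D) y - ∑ k, pd k (pd k (gradInner G F F)) y + 2 * c * D y = 0 := by
    rw [hDyF, Finset.mul_sum, ← Finset.sum_sub_distrib, ← Finset.sum_add_distrib]
    exact Finset.sum_eq_zero fun k _ => hQ2 k
  have hboch := hN.bochner hF
  have hgradD : ∀ i, ∑ k, pd i (hess G F k k) y = 0 := fun i => by
    rw [← hN.pd_laplacian hF]; exact hD1 i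
  -- In Rc(∇f,∇f) the terms c|∇f|² and -Hess f(∇f,∇f) cancel by `hQ1`, leaving α|du(∇f)|².
  have hric : ∑ i, ∑ l, ricci G i l y * pd i F y * pd l F y
      = α * ∑ i, ∑ l, pullbackCoeff h u e i l y * pd i F y * pd l F y := by
    rw [Finset.mul_sum]
    refine Finset.sum_congr rfl fun i _ => ?_
    have hr : ∀ l, ricci G i l y * pd i F y * pd l F y
        = α * (pullbackCoeff h u e i l y * pd i F y * pd l F y)
          + c * pd i F y * ((1 : Matrix (Fin m) (Fin m) ℝ) i l * pd l F y)
          - pd i F y * (pd i (pd l F) y * pd l F y) := by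
      intro l
      have := hsol.ricci_eq_of_mem_target hσ he hy i l
      rw [← hGdef, ← hFdef, hN.hess_eq, hN.eq_one] at this
      linear_combination (pd i F y * pd l F y) * this
    rw [Finset.sum_congr rfl fun l _ => hr l, Finset.sum_sub_distrib, Finset.sum_add_distrib,
      ← Finset.mul_sum, ← Finset.mul_sum, ← Finset.mul_sum, hQ1]
    simp [Matrix.one_apply]
    ring
  have hP := mul_nonneg hα (sum_pullbackCoeff_nonneg h u e y fun i => pd i F y)
  rw [hric] at hboch
  simp only [hgradD, mul_zero, Finset.sum_const_zero, add_zero] at hboch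
  rw [hDy] at hpos
  have hcD : c * D y ≤ 0 := mul_nonpos_of_nonpos_of_nonneg hc hpos.le
  -- Here c ≤ 0 and Δf > 0 make -2cΔf nonnegative, so 0 ≥ ΔΔf bounds |Hess f|² above by zero.
  have hH : ∑ i, ∑ k, pd k (pd i F) y ^ 2 ≤ 0 := by linarith
  have hnn : ∀ i, 0 ≤ ∑ k, pd k (pd i F) y ^ 2 := fun i =>
    Finset.sum_nonneg fun k _ => sq_nonneg _
  have hH0 := (Finset.sum_eq_zero_iff_of_nonneg fun i _ => hnn i).mp
    (le_antisymm hH (Finset.sum_nonneg fun i _ => hnn i))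
  have hF0 : ∀ k, pd k (pd k F) y = 0 := fun k => by
    have := (Finset.sum_eq_zero_iff_of_nonneg fun j _ => sq_nonneg _).mp
      (hH0 k (Finset.mem_univ k)) k (Finset.mem_univ k)
    exact pow_eq_zero_iff (two_ne_zero) |>.mp this
  rw [hDyF] at hpos
  simp [hF0] at hpos

/-- Trace of the soliton equation, with the trace of g equal to the dimension. -/
theorem IsGradientAlmostSoliton.scalarS_eq
    (hsol : IsGradientAlmostSoliton g h α u f σ) (hσ : ∀ x, σ x = c) (x : M) :
    scalarS g h α u x = c * m - laplacian g f x := by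
  set e := chartAt (EuclideanSpace ℝ (Fin m)) x with hedef
  have he : e ∈ maximalAtlas (𝓡 m) ∞ M := chart_mem_maximalAtlas _
  have hx : x ∈ e.source := mem_chart_source _ x
  have hG := smoothMetricOn_metricCoeff g he
  have hr : ∀ i j, scCoeff g h α u e i j (e x)
      = c * metricCoeff g e (e x) j i - hess (metricCoeff g e) (f ∘ e.symm) i j (e x) := by
    intro i j
    have := hsol.ricci_eq e he x hx i j
    rw [hσ] at this
    rw [metricCoeff_symm g _ j i]
    linarith
  have h1 : ∀ i, ∑ j, (metricCoeff g e (e x))⁻¹ i j * (c * metricCoeff g e (e x) j i) = c := by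
    intro i
    have := hG.sum_inv_mul (e.map_source hx) i i
    rw [Matrix.one_apply_eq] at this
    calc _ = c * ∑ j, (metricCoeff g e (e x))⁻¹ i j * metricCoeff g e (e x) j i := by
          rw [Finset.mul_sum]; exact Finset.sum_congr rfl fun j _ => by ring
      _ = c := by rw [this, mul_one]
  change metricTrace (metricCoeff g e) (fun i j => scCoeff g h α u e i j (e x)) (e x) = c * m -
    metricTrace (metricCoeff g e) (fun i j => hess (metricCoeff g e) (f ∘ e.symm) i j (e x)) (e x)
  simp only [metricTrace, hr, mul_sub, Finset.sum_sub_distrib, h1]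
  simp [mul_comm]

theorem laplacian_eq_zero_of_const {F : M → ℝ} (hF : ∀ x, F x = c) (x : M) :
    laplacian g F x = 0 := by
  obtain rfl : F = fun _ => c := funext hF
  have h0 : ∀ k, pd (m := m) k (fun _ => c) = fun _ => 0 := fun k => funext fun y => pd_const c k
  have h1 : ∀ k y, pd (m := m) (y := y) k (fun _ => (0 : ℝ)) = 0 := fun k y => pd_const 0 k
  simp only [laplacian, metricTrace, hess, Function.comp_def, h0]
  simp [h1]

end Soliton

end RHSoliton

end

theorem mainTheorem8 {m n : ℕ}
    {M : Type*} [TopologicalSpace M] [T2Space M] [CompactSpace M] [ConnectedSpace M]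
    [ChartedSpace (EuclideanSpace ℝ (Fin m)) M] [IsManifold (𝓡 m) ∞ M]
    {N : Type*} [TopologicalSpace N] [T2Space N] [SecondCountableTopology N]
    [ChartedSpace (EuclideanSpace ℝ (Fin n)) N] [IsManifold (𝓡 n) ∞ N]
    (g : RHSoliton.Metric m M) (h : RHSoliton.Metric n N)
    (α : ℝ) (hα : 0 < α) (u : M → N) (f σ : M → ℝ)
    (hsol : RHSoliton.IsGradientAlmostSoliton g h α u f σ)
    (hΔσ : ∀ x : M, RHSoliton.laplacian g σ x ≤ 0)
    (hσ : RHSoliton.IsSteady σ ∨ RHSoliton.IsExpanding σ) :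
    ∃ c : ℝ, ∀ x : M, RHSoliton.scalarS g h α u x = c := by
  obtain ⟨s, hs⟩ := RHSoliton.exists_eq_const_of_laplacian_nonpos g hsol.smooth_sigma hΔσ
  have hs0 : s ≤ 0 := by
    obtain ⟨x⟩ := (inferInstance : Nonempty M)
    rw [← hs x]
    exact hσ.elim (fun h0 => (h0 x).le) fun h0 => (h0 x).le
  have hΔ := RHSoliton.contMDiff_laplacian g hsol.smooth_potential
  obtain ⟨x₀, -, hx₀⟩ := isCompact_univ.exists_isMaxOn Set.univ_nonempty hΔ.continuous.continuousOn
  have hx₀' : ∀ z, RHSoliton.laplacian g f z ≤ RHSoliton.laplacian g f x₀ :=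
    fun z => hx₀ (Set.mem_univ z)
  have hΔf : ∀ x, RHSoliton.laplacian g f x ≤ 0 := fun x =>
    (hx₀' x).trans (hsol.laplacian_nonpos_of_isMax hα.le hs hs0 hx₀')
  -- The minimum principle is used again, now for f: constancy of f gives Δf = 0, so S = s m.
  obtain ⟨t, ht⟩ := RHSoliton.exists_eq_const_of_laplacian_nonpos g hsol.smooth_potential hΔf
  exact ⟨s * m, fun x => by
    rw [hsol.scalarS_eq hs, RHSoliton.laplacian_eq_zero_of_const ht, sub_zero]⟩
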